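/- Let $\mathcal E$ be a category with pullbacks. A morphism $f:A\to B$ of $\mathcal E$ is exponentiable if the pullback functor $\Delta_f:\mathcal E/B\to\mathcal E/A$ has a right adjoint $\Pi_f$; write $\Sigma_f\dashv\Delta_f$ for the left adjoint given by composition with $f$. A polynomial $p$ from $X$ to $Y$ is a diagram $$X\xleftarrow{p_1}A\xrightarrow{p_2}B\xrightarrow{p_3}Y$$ in $\mathcal E$ with $p_2$ exponentiable. A cartesian morphism $p\to q$ of polynomials from $X$ to $Y$, where $q=(X\xleftarrow{q_1}A'\xrightarrow{q_2}B'\xrightarrow{q_3}Y)$, is a pair $(f_0:A\to A',\,f_1:B\to B')$ with $q_1f_0=p_1$, $q_3f_1=p_3$, $q_2f_0=f_1p_2$, this last square being a pullback. Polynomials from $X$ to $Y$ and cartesian morphisms form a category $\mathbf{Poly}_c(\mathcal E)(X,Y)$, and these are the hom categories of a bicategory $\mathbf{Poly}_c(\mathcal E)$ whose objects are those of $\mathcal E$, whose identities are $X=X=X=X$, and in which the composite $q\circ p$ of $p:X\to Y$ and $q:Y\to Z$ (with $q=(Y\xleftarrow{q_1}A'\xrightarrow{q_2}B'\xrightarrow{q_3}Z)$)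 is $$X\xleftarrow{}F\xrightarrow{}D\xrightarrow{}Z,$$ where $D\to B'$ is $\Pi_{q_2}\Delta_{q_1}(p_3)$ and $D\to Z$ is its composite with $q_3$; $F$ is the pullback of $p_2:A\to B$ along the map $D\times_{B'}A'\to B$ given by the counit of $\Delta_{q_2}\dashv\Pi_{q_2}$ followed by the projection $A'\times_YB\to B$; $F\to D$ is $F\to D\times_{B'}A'\to D$, and $F\to X$ is $F\to A\xrightarrow{p_1}X$. Composition of 2-cells and the coherence isomorphisms are those determined by the universal properties of these pullbacks and right adjoints. Let $\mathbf{CAT}_{\mathrm{pb}}$ be the bicategory of categories with pullbacks, pullback-preserving functors, and cartesian transformations, i.e. natural transformations all of whose naturality squares are pullbacks. A $\mathbf{CAT}_{\mathrm{pb}}$-bicategory is a bicategory $\mathcal B$ whose hom categories have pullbacks and whose composition functors $\mathcal B(Y,Z)\times\mathcal B(X,Y)\to\mathcal B(X,Z)$ preserve pullbacks. A homomorphism of $\mathbf{CAT}_{\mathrm{pb}}$-bicategories is a homomorphism of bicategories (a pseudofunctor) whose hom functors preserve pullbacks. Let $\mathbf P_{\mathcal E}:\mathbf{Poly}_c(\mathcal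 E)\to\mathbf{CAT}_{\mathrm{pb}}$ be the homomorphism of bicategories given on objects by $X\mapsto\mathcal E/X$ and on polynomials by $p\mapsto\Sigma_{p_3}\Pi_{p_2}\Delta_{p_1}$, which sends a cartesian morphism $(f_0,f_1):p\to q$ to the cartesian transformation whose component at $x:C\to X$ is the map over $f_1$ from the domain of $\Pi_{p_2}\Delta_{p_1}(x)$ to the domain of $\Pi_{q_2}\Delta_{q_1}(x)$ determined by the universal property of $\Pi_{q_2}$, and whose coherence isomorphisms are the canonical comparisons. Theorem. For every category $\mathcal E$ with pullbacks, $\mathbf{Poly}_c(\mathcal E)$ is a $\mathbf{CAT}_{\mathrm{pb}}$-bicategory, $\mathbf{CAT}_{\mathrm{pb}}$ is a $\mathbf{CAT}_{\mathrm{pb}}$-bicategory, and $\mathbf P_{\mathcal E}$ is a homomorphism of $\mathbf{CAT}_{\mathrm{pb}}$-bicategories; that is: 1. for all objects $X,Y,Z$ of $\mathcal E$, the category $\mathbf{Poly}_c(\mathcal E)(X,Y)$ has pullbacks, and the composition functor $\mathbf{Poly}_c(\mathcal E)(Y,Z)\times\mathbf{Poly}_c(\mathcal E)(X,Y)\to\mathbf{Poly}_c(\mathcal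 E)(X,Z)$ preserves them; 2. the hom categories of $\mathbf{CAT}_{\mathrm{pb}}$ have pullbacks, and its composition functors preserve them; 3. for all objects $X,Y$ of $\mathcal E$, the functor $\mathbf{Poly}_c(\mathcal E)(X,Y)\to\mathbf{CAT}_{\mathrm{pb}}(\mathcal E/X,\mathcal E/Y)$ given by $\mathbf P_{\mathcal E}$ preserves pullbacks. -/

import Mathlib

open CategoryTheory CategoryTheory.Limits

universe v u

namespace PolyPb

noncomputable section

variable {E : Type u} [Category.{v} E] [HasPullbacks E]

attribute [local simp] pullback.lift_fst pullback.lift_fst_assoc pullback.lift_snd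
  pullback.lift_snd_assoc

/-- A morphism `f` is exponentiable when the pullback functor `Δ_f` has a right adjoint. -/
def Exponentiable {A B : E} (f : A ⟶ B) : Prop :=
  (Over.pullback f).IsLeftAdjoint

/-- The functor `Π_f : E/A ⥤ E/B`, right adjoint to `Δ_f`, for exponentiable `f`. -/
def piFunctor {A B : E} (f : A ⟶ B) (hf : Exponentiable f) : Over A ⥤ Over B :=
  haveI : (Over.pullback f).IsLeftAdjoint := hf
  (Over.pullback f).rightAdjoint

/-- The adjunction `Δ_f ⊣ Π_f`. -/
def piAdj {A B : E} (f : A ⟶ B) (hf : Exponentiable f) : Over.pullback f ⊣ piFunctor f hf :=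
  haveI : (Over.pullback f).IsLeftAdjoint := hf
  Adjunction.ofIsLeftAdjoint (Over.pullback f)

section Pi

variable {A B : E} {f : A ⟶ B} (hf : Exponentiable f) {Z : E} (g : Z ⟶ A)

/-- The domain of `Π_f g`. -/
def piObj : E := ((piFunctor f hf).obj (Over.mk g)).left

/-- The structure map of `Π_f g`. -/
def piOut : piObj hf g ⟶ B := ((piFunctor f hf).obj (Over.mk g)).hom

/-- The underlying map of the counit of `Δ_f ⊣ Π_f` at `g`. -/
def piEv : pullback (piOut hf g) f ⟶ Z :=
  ((piAdj f hf).counit.app (Over.mk g)).left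

/-- Evaluation of a generalized element `n` of `Π_f g` at a generalized element `a` of the
corresponding fibre of `f`. -/
def piAt {V : E} (n : V ⟶ piObj hf g) (a : V ⟶ A)
    (h : n ≫ piOut hf g = a ≫ f) : V ⟶ Z :=
  pullback.lift n a h ≫ piEv hf g

theorem piAt_w {V : E} (n : V ⟶ piObj hf g) (a : V ⟶ A)
    (h : n ≫ piOut hf g = a ≫ f) : piAt hf g n a h ≫ g = a := by
  have : piEv hf g ≫ g = pullback.snd _ _ := Over.w ((piAdj f hf).counit.app (Over.mk g))
  rw [piAt, Category.assoc, this, pullback.lift_snd]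

theorem comp_piAt {V V' : E} (k : V' ⟶ V) (n : V ⟶ piObj hf g) (a : V ⟶ A)
    (h : n ≫ piOut hf g = a ≫ f) :
    k ≫ piAt hf g n a h = piAt hf g (k ≫ n) (k ≫ a) (by simp [h]) := by
  rw [piAt, piAt, ← Category.assoc]
  congr 1
  apply pullback.hom_ext <;> simp

theorem piAt_congr {V : E} {n n' : V ⟶ piObj hf g} {a a' : V ⟶ A}
    (hn : n = n') (ha : a = a') (h : n ≫ piOut hf g = a ≫ f) :
    piAt hf g n a h = piAt hf g n' a' (by rw [← hn, ← ha, h]) := by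
  subst hn ha; rfl

/-- The action of `Π_f` on morphisms. -/
def piMap {Z' : E} {g : Z ⟶ A} {g' : Z' ⟶ A} (t : Z ⟶ Z') (ht : t ≫ g' = g) :
    piObj hf g ⟶ piObj hf g' :=
  ((piFunctor f hf).map (Over.homMk t ht : Over.mk g ⟶ Over.mk g')).left

theorem piMap_out {Z' : E} {g : Z ⟶ A} {g' : Z' ⟶ A} (t : Z ⟶ Z') (ht : t ≫ g' = g) :
    piMap hf t ht ≫ piOut hf g' = piOut hf g :=
  Over.w ((piFunctor f hf).map (Over.homMk t ht : Over.mk g ⟶ Over.mk g'))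

theorem piAt_map {Z' : E} {g : Z ⟶ A} {g' : Z' ⟶ A} (t : Z ⟶ Z') (ht : t ≫ g' = g) {V : E}
    (n : V ⟶ piObj hf g) (a : V ⟶ A) (h : (n ≫ piMap hf t ht) ≫ piOut hf g' = a ≫ f) :
    piAt hf g' (n ≫ piMap hf t ht) a h =
      piAt hf g n a (by rw [← h, Category.assoc, piMap_out]) ≫ t := by
  have : pullback.lift (pullback.fst (piOut hf g) f ≫ piMap hf t ht) (pullback.snd (piOut hf g) f)
      (by rw [Category.assoc, piMap_out, pullback.condition]) ≫ piEv hf g' = piEv hf g ≫ t :=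
    congrArg (fun t => t.left)
      ((piAdj f hf).counit.naturality (Over.homMk t ht : Over.mk g ⟶ Over.mk g'))
  rw [piAt, piAt, Category.assoc, ← this, ← Category.assoc]
  congr 1
  apply pullback.hom_ext <;> simp

theorem pi_existsUnique {W V : E} (b : W ⟶ B) (v : V ⟶ W) (a : V ⟶ A)
    (hV : IsPullback v a b f) (c : V ⟶ Z) (hc : c ≫ g = a) :
    ∃! m : W ⟶ piObj hf g, ∃ hm : m ≫ piOut hf g = b,
      piAt hf g (v ≫ m) a (by rw [Category.assoc, hm, hV.w]) = c := by
  let e := (piAdj f hf).homEquiv (Over.mk b) (Over.mk g)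
  let c' : (Over.pullback f).obj (Over.mk b) ⟶ Over.mk g :=
    Over.homMk (hV.isoPullback.inv ≫ c) (by simp [hc])
  have key : ∀ (m : W ⟶ piObj hf g) (hm : m ≫ piOut hf g = b),
      piAt hf g (v ≫ m) a (by rw [Category.assoc, hm, hV.w])
        = hV.isoPullback.hom ≫ (e.symm (Over.homMk m hm)).left := by
    intro m hm
    have h1 : (e.symm (Over.homMk m hm)).left = pullback.lift (pullback.fst b f ≫ m)
        (pullback.snd b f) (by rw [Category.assoc, hm, pullback.condition]) ≫ piEv hf g :=
      congrArg (fun t => t.left) ((piAdj f hf).homEquiv_counit (Over.mk b) (Over.mk g) (Over.homMk m hm))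
    rw [h1, ← Category.assoc hV.isoPullback.hom, piAt]
    congr 1
    apply pullback.hom_ext <;> simp
  have hw : (e c').left ≫ piOut hf g = b := Over.w (e c')
  refine ⟨(e c').left, ⟨hw, ?_⟩, ?_⟩
  · rw [key _ hw]
    have : Over.homMk (e c').left hw = e c' := rfl
    rw [this, Equiv.symm_apply_apply]
    simp [c']
  · rintro m ⟨hm, h⟩
    have h3 : e.symm (Over.homMk m hm) = c' := by
      ext
      rw [← cancel_epi hV.isoPullback.hom, ← key m hm]
      simp [c', h]
    have : Over.homMk m hm = e c' := by rw [← h3, Equiv.apply_symm_apply]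
    rw [← this]
    rfl

theorem pi_ext {W V : E} {m m' : W ⟶ piObj hf g}
    (hm : m ≫ piOut hf g = m' ≫ piOut hf g)
    {v : V ⟶ W} {a : V ⟶ A} (hV : IsPullback v a (m ≫ piOut hf g) f)
    (h : piAt hf g (v ≫ m) a (by rw [Category.assoc, hV.w]) =
      piAt hf g (v ≫ m') a (by rw [Category.assoc, ← hm, hV.w])) : m = m' :=
  (pi_existsUnique hf g _ v a hV _ (piAt_w hf g _ _ _)).unique ⟨rfl, h⟩ ⟨hm.symm, rfl⟩

/-- The map into `Π_f g` classified by a map `c` out of a pullback along `f`. -/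
def piLift {W V : E} (b : W ⟶ B) (v : V ⟶ W) (a : V ⟶ A)
    (hV : IsPullback v a b f) (c : V ⟶ Z) (hc : c ≫ g = a) : W ⟶ piObj hf g :=
  (pi_existsUnique hf g b v a hV c hc).choose

theorem piLift_out {W V : E} (b : W ⟶ B) (v : V ⟶ W) (a : V ⟶ A)
    (hV : IsPullback v a b f) (c : V ⟶ Z) (hc : c ≫ g = a) :
    piLift hf g b v a hV c hc ≫ piOut hf g = b :=
  (pi_existsUnique hf g b v a hV c hc).choose_spec.1.choose

theorem piAt_piLift {W V : E} (b : W ⟶ B) (v : V ⟶ W) (a : V ⟶ A)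
    (hV : IsPullback v a b f) (c : V ⟶ Z) (hc : c ≫ g = a) :
    piAt hf g (v ≫ piLift hf g b v a hV c hc) a
      (by rw [Category.assoc, piLift_out, hV.w]) = c :=
  (pi_existsUnique hf g b v a hV c hc).choose_spec.1.choose_spec

end Pi

/-- Existence of distributivity pullbacks along `f` implies exponentiability. -/
theorem exponentiable_of_universal {A B : E} (f : A ⟶ B)
    (H : ∀ z : Over A, ∃ (P : Over B) (ev : pullback P.hom f ⟶ z.left)
      (_ : ev ≫ z.hom = pullback.snd _ _),
      ∀ (W : E) (b : W ⟶ B) (c : pullback b f ⟶ z.left), c ≫ z.hom = pullback.snd _ _ →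
        ∃! m : W ⟶ P.left, ∃ hm : m ≫ P.hom = b,
          pullback.lift (pullback.fst b f ≫ m) (pullback.snd b f)
            (by rw [Category.assoc, hm, pullback.condition]) ≫ ev = c) :
    Exponentiable f := by
  have : ∀ z : Over A, HasTerminal (CostructuredArrow (Over.pullback f) z) := by
    intro z
    obtain ⟨P, ev, hev, h⟩ := H z
    let T : CostructuredArrow (Over.pullback f) z := CostructuredArrow.mk
      (Y := P) (Over.homMk ev hev)
    have hU : ∀ S : CostructuredArrow (Over.pullback f) z, Nonempty (Unique (S ⟶ T)) := by
      intro S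
      obtain ⟨m, ⟨hm, h1⟩, h2⟩ := h S.left.left S.left.hom S.hom.left (Over.w S.hom)
      refine ⟨⟨⟨CostructuredArrow.homMk (Over.homMk m hm) ?_⟩, ?_⟩⟩
      · ext
        rw [← h1]
        simp [T]
      · intro g
        ext
        apply h2
        refine ⟨Over.w g.left, ?_⟩
        have := congrArg (fun t => t.left) (CostructuredArrow.w g)
        dsimp at this
        rw [← this]
        simp [T]
    have : ∀ S, Unique (S ⟶ T) := fun S => (hU S).some
    exact hasTerminal_of_unique T
  exact isLeftAdjoint_of_costructuredArrowTerminals _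

theorem Exponentiable.id (A : E) : Exponentiable (𝟙 A) := by
  exact Functor.isLeftAdjoint_of_iso (Over.pullbackId (X := A)).symm

theorem Exponentiable.comp {A B C : E} {f : A ⟶ B} {g : B ⟶ C} (hf : Exponentiable f)
    (hg : Exponentiable g) : Exponentiable (f ≫ g) := by
  have : (Over.pullback f).IsLeftAdjoint := hf
  have : (Over.pullback g).IsLeftAdjoint := hg
  exact Functor.isLeftAdjoint_of_iso (Over.pullbackComp f g).symm

theorem Exponentiable.of_isPullback {A B C D : E} {t : A ⟶ B} {h : A ⟶ C} {k : B ⟶ D}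
    {g : C ⟶ D} (sq : IsPullback t h k g) (hk : Exponentiable k) : Exponentiable h := by
  apply exponentiable_of_universal
  intro z
  let zt : z.left ⟶ B := z.hom ≫ t
  let Pz : piObj hk zt ⟶ piObj hk t := piMap hk z.hom rfl
  let s : C ⟶ piObj hk t := piLift hk t g h t sq.flip (𝟙 A) (Category.id_comp t)
  have hs : s ≫ piOut hk t = g := piLift_out hk t g h t sq.flip (𝟙 A) (Category.id_comp t)
  have hs1 {V : E} (y : V ⟶ A) (n : V ⟶ piObj hk t) (a : V ⟶ B) (hn : n = y ≫ h ≫ s)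
      (ha : a = y ≫ t) (hna : n ≫ piOut hk t = a ≫ k) : piAt hk t n a hna = y := by
    subst hn ha
    rw [← comp_piAt hk t y (h ≫ s) t (by rw [Category.assoc, hs, sq.w])]
    have := piAt_piLift hk t g h t sq.flip (𝟙 A) (Category.id_comp t)
    rw [this, Category.comp_id]
  have hPz : Pz ≫ piOut hk t = piOut hk zt := piMap_out hk _ _
  have hR : pullback.fst Pz s ≫ piOut hk zt = pullback.snd Pz s ≫ g := by
    rw [← hPz, pullback.condition_assoc, hs]
  let r := pullback.snd Pz s
  have hc : (pullback.fst r h ≫ pullback.fst Pz s) ≫ piOut hk zt =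
      (pullback.snd r h ≫ t) ≫ k := by
    rw [Category.assoc, hR, pullback.condition_assoc, Category.assoc, sq.w]
  refine ⟨Over.mk r, piAt hk zt (pullback.fst r h ≫ pullback.fst Pz s)
    (pullback.snd r h ≫ t) hc, ?_, ?_⟩
  · have h1 := piAt_map hk z.hom rfl (pullback.fst r h ≫ pullback.fst Pz s)
      (pullback.snd r h ≫ t) (by rw [Category.assoc, piMap_out]; exact hc)
    rw [← h1]
    apply hs1 _ _ _ _ rfl
    change (pullback.fst r h ≫ pullback.fst Pz s) ≫ Pz = pullback.snd r h ≫ h ≫ s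
    rw [Category.assoc, pullback.condition, pullback.condition_assoc]
  · intro W b c hcz
    have hV : IsPullback (pullback.fst b h) (pullback.snd b h ≫ t) (b ≫ g) k :=
      (IsPullback.of_hasPullback b h).flip.paste_horiz sq |>.flip
    have hct : c ≫ zt = pullback.snd b h ≫ t := by
      simp [zt, reassoc_of% hcz]
    let m₁ := piLift hk zt (b ≫ g) _ _ hV c hct
    have hm₁ : m₁ ≫ piOut hk zt = b ≫ g := piLift_out hk zt (b ≫ g) _ _ hV c hct
    have hm₁' := piAt_piLift hk zt (b ≫ g) _ _ hV c hct
    have hm₂ : m₁ ≫ Pz = b ≫ s := by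
      have e1 : (m₁ ≫ Pz) ≫ piOut hk t = b ≫ g := by rw [Category.assoc, hPz, hm₁]
      refine pi_ext hk t (v := pullback.fst b h) (a := pullback.snd b h ≫ t)
        (by rw [e1, Category.assoc, hs]) ?_ ?_
      · rw [e1]; exact hV
      · rw [hs1 (pullback.snd b h) (pullback.fst b h ≫ b ≫ s) _
          (by rw [pullback.condition_assoc]) rfl]
        have := piAt_map hk z.hom rfl (pullback.fst b h ≫ m₁) (pullback.snd b h ≫ t)
          (by rw [Category.assoc, Category.assoc, piMap_out, hm₁]; exact hV.w)
        rw [piAt_congr hk t (Category.assoc _ _ _).symm rfl]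
        refine this.trans ?_
        rw [hm₁']
        exact hcz
    refine ⟨pullback.lift m₁ b hm₂, ⟨pullback.lift_snd _ _ _, ?_⟩, ?_⟩
    · rw [comp_piAt]
      refine (piAt_congr hk zt ?_ ?_ _).trans hm₁'
      · simp [m₁]
      · simp
    · rintro m ⟨hm, hm'⟩
      apply pullback.hom_ext
      · rw [pullback.lift_fst]
        refine (pi_existsUnique hk zt (b ≫ g) _ _ hV c hct).unique ⟨?_, ?_⟩ ⟨hm₁, hm₁'⟩
        · rw [Category.assoc, hR, ← Category.assoc]
          congr 1
        · rw [← hm', comp_piAt]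
          apply piAt_congr
          · simp
          · simp
      · rw [pullback.lift_snd]
        exact hm

/-- A polynomial `X ←p₁- A -p₂→ B -p₃→ Y` from `X` to `Y`, with `p₂` exponentiable. -/
structure Poly (X Y : E) where
  A : E
  B : E
  p₁ : A ⟶ X
  p₂ : A ⟶ B
  p₃ : B ⟶ Y
  exp : Exponentiable p₂

namespace Poly

/-- A cartesian morphism of polynomials. -/
@[ext]
structure Hom {X Y : E} (p q : Poly X Y) where
  f₀ : p.A ⟶ q.A
  f₁ : p.B ⟶ q.B
  w₁ : f₀ ≫ q.p₁ = p.p₁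
  isPullback : IsPullback f₀ p.p₂ q.p₂ f₁
  w₃ : f₁ ≫ q.p₃ = p.p₃

/-- The category of polynomials from `X` to `Y` and cartesian morphisms. -/
instance (X Y : E) : Category (Poly X Y) where
  Hom p q := Hom p q
  id p := ⟨𝟙 _, 𝟙 _, by simp, IsPullback.of_horiz_isIso ⟨by simp⟩, by simp⟩
  comp f g := ⟨f.f₀ ≫ g.f₀, f.f₁ ≫ g.f₁, by simp [g.w₁, f.w₁],
    f.isPullback.paste_horiz g.isPullback, by simp [g.w₃, f.w₃]⟩
  id_comp f := by ext <;> simp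
  comp_id f := by ext <;> simp
  assoc f g h := by ext <;> simp

variable {X Y Z : E}

@[ext]
theorem hom_ext {p q : Poly X Y} {f g : p ⟶ q} (h₀ : f.f₀ = g.f₀) (h₁ : f.f₁ = g.f₁) : f = g :=
  Hom.ext h₀ h₁

@[simp] theorem id_f₀ (p : Poly X Y) : Hom.f₀ (𝟙 p) = 𝟙 p.A := rfl
@[simp] theorem id_f₁ (p : Poly X Y) : Hom.f₁ (𝟙 p) = 𝟙 p.B := rfl
@[simp] theorem comp_f₀ {p q r : Poly X Y} (f : p ⟶ q) (g : q ⟶ r) :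
    (f ≫ g).f₀ = f.f₀ ≫ g.f₀ := rfl
@[simp] theorem comp_f₁ {p q r : Poly X Y} (f : p ⟶ q) (g : q ⟶ r) :
    (f ≫ g).f₁ = f.f₁ ≫ g.f₁ := rfl

@[simp] theorem Hom.w₁' {p q : Poly X Y} (f : p ⟶ q) : f.f₀ ≫ q.p₁ = p.p₁ := f.w₁
@[simp] theorem Hom.w₁'_assoc {p q : Poly X Y} (f : p ⟶ q) {T : E} (k : X ⟶ T) :
    f.f₀ ≫ q.p₁ ≫ k = p.p₁ ≫ k := by rw [← Category.assoc, f.w₁']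
theorem Hom.w₂ {p q : Poly X Y} (f : p ⟶ q) : f.f₀ ≫ q.p₂ = p.p₂ ≫ f.f₁ :=
  f.isPullback.w
theorem Hom.w₂_assoc {p q : Poly X Y} (f : p ⟶ q) {T : E} (k : q.B ⟶ T) :
    f.f₀ ≫ q.p₂ ≫ k = p.p₂ ≫ f.f₁ ≫ k := by rw [← Category.assoc, f.w₂, Category.assoc]
@[simp] theorem Hom.w₃' {p q : Poly X Y} (f : p ⟶ q) : f.f₁ ≫ q.p₃ = p.p₃ := f.w₃
@[simp] theorem Hom.w₃'_assoc {p q : Poly X Y} (f : p ⟶ q) {T : E} (k : Y ⟶ T) :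
    f.f₁ ≫ q.p₃ ≫ k = p.p₃ ≫ k := by rw [← Category.assoc, f.w₃']

/-- The polynomial functor `Σ_{p₃} Π_{p₂} Δ_{p₁} : E/X ⥤ E/Y`. -/
def functor (p : Poly X Y) : Over X ⥤ Over Y :=
  Over.pullback p.p₁ ⋙ piFunctor p.p₂ p.exp ⋙ Over.map p.p₃

section Ext

variable (p : Poly X Y) {C : E} (x : C ⟶ X)

/-- The domain of `p(x)`. -/
def ext : E := piObj p.exp (pullback.snd x p.p₁)

/-- The projection of the domain of `p(x)` to `p.B`. -/
def out : p.ext x ⟶ p.B := piOut p.exp (pullback.snd x p.p₁)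

/-- The object `p(x)` of `E/Y`, as a map. -/
def leg : p.ext x ⟶ Y := p.out x ≫ p.p₃

theorem out_leg : p.out x ≫ p.p₃ = p.leg x := rfl

theorem functor_obj (x : Over X) : p.functor.obj x = Over.mk (p.leg x.hom) := rfl

variable {W V V' : E}

/-- Evaluation of generalized elements of `p(x)`. -/
def ev (n : V ⟶ p.ext x) (a : V ⟶ p.A) (h : n ≫ p.out x = a ≫ p.p₂) : V ⟶ C :=
  piAt p.exp (pullback.snd x p.p₁) n a h ≫ pullback.fst _ _

theorem ev_w (n : V ⟶ p.ext x) (a : V ⟶ p.A) (h : n ≫ p.out x = a ≫ p.p₂) :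
    p.ev x n a h ≫ x = a ≫ p.p₁ := by
  rw [ev, Category.assoc, pullback.condition, ← Category.assoc]
  exact congrArg (· ≫ p.p₁) (piAt_w p.exp (pullback.snd x p.p₁) n a h)

theorem comp_ev (k : V' ⟶ V) (n : V ⟶ p.ext x) (a : V ⟶ p.A) (h : n ≫ p.out x = a ≫ p.p₂) :
    k ≫ p.ev x n a h = p.ev x (k ≫ n) (k ≫ a) (by simp [h]) := by
  rw [ev, ev, ← Category.assoc]
  exact congrArg (· ≫ pullback.fst x p.p₁) (comp_piAt p.exp (pullback.snd x p.p₁) k n a h)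

theorem ev_congr {n n' : V ⟶ p.ext x} {a a' : V ⟶ p.A} (hn : n = n') (ha : a = a')
    (h : n ≫ p.out x = a ≫ p.p₂) : p.ev x n a h = p.ev x n' a' (by rw [← hn, ← ha, h]) := by
  subst hn ha; rfl

variable {x} in
theorem ext_ext {m m' : W ⟶ p.ext x} (hm : m ≫ p.out x = m' ≫ p.out x) {v : V ⟶ W} {a : V ⟶ p.A}
    {b : W ⟶ p.B} (hV : IsPullback v a b p.p₂) (hb : b = m ≫ p.out x)
    (h : p.ev x (v ≫ m) a (by rw [Category.assoc, ← hb, hV.w]) =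
      p.ev x (v ≫ m') a (by rw [Category.assoc, ← hm, ← hb, hV.w])) : m = m' := by
  subst hb
  apply pi_ext p.exp _ hm hV
  apply pullback.hom_ext
  · exact h
  · exact (piAt_w _ _ _ _ _).trans (piAt_w _ _ _ _ _).symm

/-- The map into `p(x)` classified by a map `c` out of a pullback along `p₂`. -/
def lift (b : W ⟶ p.B) (v : V ⟶ W) (a : V ⟶ p.A) (hV : IsPullback v a b p.p₂) (c : V ⟶ C)
    (hc : c ≫ x = a ≫ p.p₁) : W ⟶ p.ext x :=
  piLift p.exp _ b v a hV (pullback.lift c a hc) (pullback.lift_snd _ _ _)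

theorem lift_out (b : W ⟶ p.B) (v : V ⟶ W) (a : V ⟶ p.A) (hV : IsPullback v a b p.p₂) (c : V ⟶ C)
    (hc : c ≫ x = a ≫ p.p₁) : p.lift x b v a hV c hc ≫ p.out x = b :=
  piLift_out _ _ _ _ _ _ _ _

theorem lift_out_assoc (b : W ⟶ p.B) (v : V ⟶ W) (a : V ⟶ p.A) (hV : IsPullback v a b p.p₂)
    (c : V ⟶ C) (hc : c ≫ x = a ≫ p.p₁) {T : E} (k : p.B ⟶ T) :
    p.lift x b v a hV c hc ≫ p.out x ≫ k = b ≫ k := by rw [← Category.assoc, lift_out]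

theorem ev_lift (b : W ⟶ p.B) (v : V ⟶ W) (a : V ⟶ p.A) (hV : IsPullback v a b p.p₂) (c : V ⟶ C)
    (hc : c ≫ x = a ≫ p.p₁) (k : V' ⟶ V) {n : V' ⟶ p.ext x} {a' : V' ⟶ p.A}
    (hn : n = k ≫ v ≫ p.lift x b v a hV c hc) (ha : a' = k ≫ a) (h : n ≫ p.out x = a' ≫ p.p₂) :
    p.ev x n a' h = k ≫ c := by
  subst hn ha
  rw [← comp_ev _ _ _ _ _ (by rw [Category.assoc, lift_out, hV.w])]
  congr 1
  have h1 := piAt_piLift p.exp _ b v a hV (pullback.lift c a hc) (pullback.lift_snd _ _ _)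
  exact (congrArg (· ≫ pullback.fst x p.p₁) h1).trans (pullback.lift_fst _ _ _)

/-- The action of `p` on morphisms of `E/X`. -/
def map {C' : E} {x : C ⟶ X} {x' : C' ⟶ X} (t : C ⟶ C') (ht : t ≫ x' = x) : p.ext x ⟶ p.ext x' :=
  (p.functor.map (Over.homMk t ht : Over.mk x ⟶ Over.mk x')).left

@[simp]
theorem map_out {C' : E} {x : C ⟶ X} {x' : C' ⟶ X} (t : C ⟶ C') (ht : t ≫ x' = x) :
    p.map t ht ≫ p.out x' = p.out x :=
  Over.w ((piFunctor p.p₂ p.exp).map ((Over.pullback p.p₁).map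
    (Over.homMk t ht : Over.mk x ⟶ Over.mk x')))

@[simp]
theorem map_out_assoc {C' : E} {x : C ⟶ X} {x' : C' ⟶ X} (t : C ⟶ C') (ht : t ≫ x' = x) {T : E}
    (k : p.B ⟶ T) : p.map t ht ≫ p.out x' ≫ k = p.out x ≫ k := by
  rw [← Category.assoc, map_out]

theorem ev_map {C' : E} {x : C ⟶ X} {x' : C' ⟶ X} (t : C ⟶ C') (ht : t ≫ x' = x)
    (n : V ⟶ p.ext x) (a : V ⟶ p.A) (h : (n ≫ p.map t ht) ≫ p.out x' = a ≫ p.p₂) :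
    p.ev x' (n ≫ p.map t ht) a h = p.ev x n a (by simpa using h) ≫ t := by
  have h1 := piAt_map p.exp (g := pullback.snd x p.p₁) (g' := pullback.snd x' p.p₁)
    ((Over.pullback p.p₁).map (Over.homMk t ht : Over.mk x ⟶ Over.mk x')).left (Over.w _) n a h
  refine (congrArg (· ≫ pullback.fst x' p.p₁) h1).trans ?_
  simp [ev]

theorem isPullback_out : IsPullback (pullback.fst (p.out x) p.p₂) (pullback.snd (p.out x) p.p₂)
    (p.out x) p.p₂ := IsPullback.of_hasPullback _ _

end Ext

theorem isPullback_app {p q : Poly X Y} (f : p ⟶ q) {C : E} (x : C ⟶ X) :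
    IsPullback (pullback.fst (p.out x) p.p₂) (pullback.snd (p.out x) p.p₂ ≫ f.f₀)
      (p.out x ≫ f.f₁) q.p₂ :=
  ((p.isPullback_out x).flip.paste_horiz f.isPullback.flip.flip).flip

/-- The component at `x` of the natural transformation induced by a cartesian morphism. -/
def app {p q : Poly X Y} (f : p ⟶ q) {C : E} (x : C ⟶ X) : p.ext x ⟶ q.ext x :=
  q.lift x (p.out x ≫ f.f₁) (pullback.fst (p.out x) p.p₂) (pullback.snd (p.out x) p.p₂ ≫ f.f₀)
    (isPullback_app f x)
    (p.ev x (pullback.fst _ _) (pullback.snd _ _) pullback.condition)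
    (by rw [ev_w, Category.assoc, f.w₁'])

section App

variable {p q r : Poly X Y} (f : p ⟶ q) (g : q ⟶ r) {C C' : E} (x : C ⟶ X) {V : E}

@[simp]
theorem app_out : app f x ≫ q.out x = p.out x ≫ f.f₁ := lift_out _ _ _ _ _ _ _ _

@[simp]
theorem app_out_assoc {T : E} (k : q.B ⟶ T) :
    app f x ≫ q.out x ≫ k = p.out x ≫ f.f₁ ≫ k := by
  rw [← Category.assoc, app_out, Category.assoc]

@[simp]
theorem app_leg : app f x ≫ q.leg x = p.leg x := by simp [leg]

@[simp]
theorem app_leg_assoc {T : E} (k : Y ⟶ T) : app f x ≫ q.leg x ≫ k = p.leg x ≫ k := by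
  rw [← Category.assoc, app_leg]

theorem ev_app (n : V ⟶ p.ext x) (a : V ⟶ p.A) (h : n ≫ p.out x = a ≫ p.p₂)
    {n' : V ⟶ q.ext x} {a' : V ⟶ q.A} (hn : n' = n ≫ app f x) (ha : a' = a ≫ f.f₀)
    (h' : n' ≫ q.out x = a' ≫ q.p₂) : q.ev x n' a' h' = p.ev x n a h := by
  refine (ev_lift q x (p.out x ≫ f.f₁) _ _ (isPullback_app f x)
    (p.ev x (pullback.fst _ _) (pullback.snd _ _) pullback.condition)
    (by rw [ev_w, Category.assoc, f.w₁']) (pullback.lift n a h) ?_ ?_ h').trans ?_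
  · rw [hn, pullback.lift_fst_assoc]; rfl
  · rw [ha, pullback.lift_snd_assoc]
  rw [comp_ev]
  exact ev_congr _ _ (by simp) (by simp) _

theorem app_id : app (𝟙 p) x = 𝟙 _ := by
  refine p.ext_ext (by simp) (p.isPullback_out x) (by simp) ?_
  rw [ev_app (𝟙 p) x (pullback.fst _ _) (pullback.snd _ _) pullback.condition rfl (by simp)]
  exact ev_congr _ _ (by simp) rfl _

theorem app_comp : app (f ≫ g) x = app f x ≫ app g x := by
  refine r.ext_ext (by simp) (isPullback_app (f ≫ g) x) (by simp) ?_
  rw [ev_app (f ≫ g) x (pullback.fst _ _) (pullback.snd _ _) pullback.condition rfl (by simp),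
    ev_app g x (pullback.fst _ _ ≫ app f x) (pullback.snd _ _ ≫ f.f₀)
      (by simp [pullback.condition_assoc, f.w₂]) (by simp) (by simp),
    ev_app f x (pullback.fst _ _) (pullback.snd _ _) pullback.condition rfl rfl]

theorem map_app {x : C ⟶ X} {x' : C' ⟶ X} (t : C ⟶ C') (ht : t ≫ x' = x) :
    p.map t ht ≫ app f x' = app f x ≫ q.map t ht := by
  refine q.ext_ext (by simp) (isPullback_app f x) (by simp) ?_
  rw [ev_app f x' (pullback.fst _ _ ≫ p.map t ht) (pullback.snd _ _)
      (by simp [pullback.condition]) (by simp) (by simp),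
    ev_congr q x' (Category.assoc _ _ _).symm rfl, ev_map, ev_map,
    ev_app f x (pullback.fst _ _) (pullback.snd _ _) pullback.condition rfl rfl]

end App

end Poly

namespace Poly

theorem map_id {X Y : E} (p : Poly X Y) {C : E} (x : C ⟶ X) (h : 𝟙 C ≫ x = x) :
    p.map (𝟙 C) h = 𝟙 _ :=
  congrArg (fun t => t.left) (p.functor.map_id (Over.mk x))

theorem map_comp {X Y : E} (p : Poly X Y) {C C' C'' : E} {x : C ⟶ X} {x' : C' ⟶ X} {x'' : C'' ⟶ X}
    (t : C ⟶ C') (ht : t ≫ x' = x) (t' : C' ⟶ C'') (ht' : t' ≫ x'' = x') :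
    p.map t ht ≫ p.map t' ht' = p.map (t ≫ t') (by simp [ht, ht']) :=
  congrArg (fun t => t.left) (p.functor.map_comp (Over.homMk t ht : Over.mk x ⟶ Over.mk x')
    (Over.homMk t' ht' : Over.mk x' ⟶ Over.mk x'')).symm

@[simp]
theorem map_leg {X Y : E} (p : Poly X Y) {C C' : E} {x : C ⟶ X} {x' : C' ⟶ X}
    (t : C ⟶ C') (ht : t ≫ x' = x) : p.map t ht ≫ p.leg x' = p.leg x := by
  simp [leg]

@[simp]
theorem map_leg_assoc {X Y : E} (p : Poly X Y) {C C' : E} {x : C ⟶ X} {x' : C' ⟶ X}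
    (t : C ⟶ C') (ht : t ≫ x' = x) {T : E} (k : Y ⟶ T) :
    p.map t ht ≫ p.leg x' ≫ k = p.leg x ≫ k := by
  rw [← Category.assoc, map_leg]

section Comp

variable {X Y Z : E} (p : Poly X Y) (q : Poly Y Z)

/-- The object in the middle of the subdivided composite of `p` and `q`. -/
def mid : E := pullback (q.out p.p₃) q.p₂

/-- The map from the middle object to `q(p₃)`, the last object of the subdivided composite. -/
def midFst : mid p q ⟶ q.ext p.p₃ := pullback.fst _ _

/-- The map from the middle object to `q.A`. -/
def midSnd : mid p q ⟶ q.A := pullback.snd _ _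

theorem isPullback_mid : IsPullback (midFst p q) (midSnd p q) (q.out p.p₃) q.p₂ :=
  IsPullback.of_hasPullback _ _

/-- The map from the middle object to `p.B`. -/
def midEv : mid p q ⟶ p.B := q.ev p.p₃ (midFst p q) (midSnd p q) (isPullback_mid p q).w

theorem midEv_w : midEv p q ≫ p.p₃ = midSnd p q ≫ q.p₁ := ev_w _ _ _ _ _

/-- The first object of the subdivided composite of `p` and `q`. -/
def top : E := pullback (midEv p q) p.p₂

/-- The map from the first object of the subdivided composite to the middle one. -/
def toMid : top p q ⟶ mid p q := pullback.fst _ _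

/-- The map from the first object of the subdivided composite to `p.A`. -/
def a₁ : top p q ⟶ p.A := pullback.snd _ _

/-- The map from the first object of the subdivided composite to `q.A`. -/
def a₂ : top p q ⟶ q.A := toMid p q ≫ midSnd p q

theorem isPullback_top : IsPullback (toMid p q) (a₁ p q) (midEv p q) p.p₂ :=
  IsPullback.of_hasPullback _ _

/-- The composite map from the first object of the subdivided composite to the last one. -/
def bot : top p q ⟶ q.ext p.p₃ := toMid p q ≫ midFst p q

/-- The composite of polynomials, first `p` and then `q`: the pullback of `p.p₃` along `q.p₁`, then
the distributivity pullback around `q.p₂` (with `q.ext p.p₃ = Π_{q₂} Δ_{q₁} p₃` as its base), then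
the pullback along `p.p₂`. -/
abbrev comp : Poly X Z where
  A := top p q
  B := q.ext p.p₃
  p₁ := a₁ p q ≫ p.p₁
  p₂ := bot p q
  p₃ := q.leg p.p₃
  exp := (Exponentiable.of_isPullback (isPullback_top p q).flip p.exp).comp
    (Exponentiable.of_isPullback (isPullback_mid p q).flip q.exp)

variable {p q} in
theorem top_ext {T : E} {s t : T ⟶ top p q} (h : s ≫ toMid p q ≫ midFst p q = t ≫ toMid p q ≫ midFst p q)
    (h₁ : s ≫ a₁ p q = t ≫ a₁ p q) (h₂ : s ≫ a₂ p q = t ≫ a₂ p q) : s = t := by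
  apply (isPullback_top p q).hom_ext
  · apply (isPullback_mid p q).hom_ext
    · simpa using h
    · simpa [a₂] using h₂
  · exact h₁

variable {p q} in
theorem comp_hom_ext {r : Poly X Z} {f g : r ⟶ comp p q} (h : f.f₁ = g.f₁)
    (h₁ : f.f₀ ≫ a₁ p q = g.f₀ ≫ a₁ p q) (h₂ : f.f₀ ≫ a₂ p q = g.f₀ ≫ a₂ p q) : f = g := by
  apply hom_ext
  · apply top_ext _ h₁ h₂
    have hf := f.w₂
    have hg := g.w₂
    exact hf.trans ((congrArg (r.p₂ ≫ ·) h).trans hg.symm)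
  · exact h

section HomComp

variable {W R V : E} (k : R ⟶ W) (d : W ⟶ q.B) (c : R ⟶ q.A) (hq : IsPullback k c d q.p₂)
  (b : R ⟶ p.B) (hcb : b ≫ p.p₃ = c ≫ q.p₁) (l : V ⟶ R) (a : V ⟶ p.A)
  (hp : IsPullback l a b p.p₂)

/-- The comparison map into the middle object of the subdivided composite. -/
def midLift : R ⟶ mid p q := (isPullback_mid p q).lift
  (k ≫ q.lift p.p₃ d k c hq b hcb) c (by rw [Category.assoc, lift_out, hq.w])

theorem midLift_fst : midLift p q k d c hq b hcb ≫ midFst p q = k ≫ q.lift p.p₃ d k c hq b hcb :=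
  (isPullback_mid p q).lift_fst _ _ _

theorem midLift_snd : midLift p q k d c hq b hcb ≫ midSnd p q = c :=
  (isPullback_mid p q).lift_snd _ _ _

theorem midLift_ev : midLift p q k d c hq b hcb ≫ midEv p q = b := by
  rw [midEv, comp_ev]
  exact (ev_lift q p.p₃ d k c hq b hcb (𝟙 _) ((midLift_fst ..).trans (Category.id_comp _).symm)
    ((midLift_snd ..).trans (Category.id_comp _).symm) _).trans (Category.id_comp _)

theorem isPullback_midLift : IsPullback (midLift p q k d c hq b hcb) k (midFst p q)
    (q.lift p.p₃ d k c hq b hcb) := by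
  refine IsPullback.of_right (h₁₂ := midSnd p q) (h₂₂ := q.out p.p₃) ?_ (midLift_fst ..)
    (isPullback_mid p q).flip
  rw [midLift_snd, lift_out]
  exact hq.flip

/-- The comparison map into the first object of the subdivided composite. -/
def topLift : V ⟶ top p q := (isPullback_top p q).lift (l ≫ midLift p q k d c hq b hcb) a
  (by rw [Category.assoc, midLift_ev, hp.w])

theorem topLift_toMid : topLift p q k d c hq b hcb l a hp ≫ toMid p q =
    l ≫ midLift p q k d c hq b hcb := (isPullback_top p q).lift_fst _ _ _

theorem topLift_a₁ : topLift p q k d c hq b hcb l a hp ≫ a₁ p q = a :=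
  (isPullback_top p q).lift_snd _ _ _

theorem isPullback_topLift : IsPullback (topLift p q k d c hq b hcb l a hp) l (toMid p q)
    (midLift p q k d c hq b hcb) := by
  refine IsPullback.of_right (h₁₂ := a₁ p q) (h₂₂ := midEv p q) ?_ (topLift_toMid ..)
    (isPullback_top p q).flip
  rw [topLift_a₁, midLift_ev]
  exact hp.flip

/-- The universal property of the subdivided composite: a factorization of `r` as a subdivided
composite over `p` and `q` determines a morphism from `r` to the composite. -/
def homComp (r : Poly X Z) {R : E} (l : r.A ⟶ R) (k : R ⟶ r.B) (hlk : l ≫ k = r.p₂)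
    (d : r.B ⟶ q.B) (c : R ⟶ q.A) (hq : IsPullback k c d q.p₂)
    (b : R ⟶ p.B) (a : r.A ⟶ p.A) (hp : IsPullback l a b p.p₂)
    (hcb : b ≫ p.p₃ = c ≫ q.p₁) (ha : a ≫ p.p₁ = r.p₁) (hd : d ≫ q.p₃ = r.p₃) :
    r ⟶ comp p q where
  f₁ := q.lift p.p₃ d k c hq b hcb
  f₀ := topLift p q k d c hq b hcb l a hp
  w₁ := ((Category.assoc _ _ _).symm.trans
    (congrArg (· ≫ p.p₁) (topLift_a₁ p q k d c hq b hcb l a hp))).trans ha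
  w₃ := by rw [← hd]; exact lift_out_assoc _ _ _ _ _ _ _ _ _
  isPullback := by
    rw [← hlk]
    exact (isPullback_topLift p q k d c hq b hcb l a hp).paste_vert
      (isPullback_midLift p q k d c hq b hcb)

end HomComp

section HomCompLaws

variable {p q} {r : Poly X Z} {R : E} (l : r.A ⟶ R) (k : R ⟶ r.B) (hlk : l ≫ k = r.p₂)
    (d : r.B ⟶ q.B) (c : R ⟶ q.A) (hq : IsPullback k c d q.p₂)
    (b : R ⟶ p.B) (a : r.A ⟶ p.A) (hp : IsPullback l a b p.p₂)
    (hcb : b ≫ p.p₃ = c ≫ q.p₁) (ha : a ≫ p.p₁ = r.p₁) (hd : d ≫ q.p₃ = r.p₃)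

theorem homComp_f₁ : (homComp p q r l k hlk d c hq b a hp hcb ha hd).f₁ =
    q.lift p.p₃ d k c hq b hcb := rfl

theorem homComp_f₀_a₁ : (homComp p q r l k hlk d c hq b a hp hcb ha hd).f₀ ≫ a₁ p q = a :=
  topLift_a₁ p q k d c hq b hcb l a hp

theorem homComp_f₀_a₂ : (homComp p q r l k hlk d c hq b a hp hcb ha hd).f₀ ≫ a₂ p q = l ≫ c := by
  refine (Category.assoc _ _ _).symm.trans ?_
  refine (congrArg (· ≫ midSnd p q) (topLift_toMid p q k d c hq b hcb l a hp)).trans ?_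
  simp only [Category.assoc, midLift_snd]

end HomCompLaws

end Comp

end Poly

namespace Poly

theorem ext_ext' {X Y : E} (p : Poly X Y) {C : E} {x : C ⟶ X} {W : E} {m m' : W ⟶ p.ext x}
    (hm : m ≫ p.out x = m' ≫ p.out x)
    (h : ∀ (V : E) (v : V ⟶ W) (a : V ⟶ p.A) (h₁ : (v ≫ m) ≫ p.out x = a ≫ p.p₂)
      (h₂ : (v ≫ m') ≫ p.out x = a ≫ p.p₂), p.ev x (v ≫ m) a h₁ = p.ev x (v ≫ m') a h₂) :
    m = m' :=
  p.ext_ext hm (IsPullback.of_hasPullback (m ≫ p.out x) p.p₂) rfl (h _ _ _ _ _)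

variable {X Y Z : E} (p : Poly X Y) (q : Poly Y Z) {C : E} (x : C ⟶ X)

theorem comp_ext_ext {W : E} {m m' : W ⟶ q.ext (p.leg x)}
    (hm : m ≫ q.out _ = m' ≫ q.out _)
    (hm' : ∀ (V : E) (v : V ⟶ W) (a : V ⟶ q.A) (h₁ : (v ≫ m) ≫ q.out _ = a ≫ q.p₂)
      (h₂ : (v ≫ m') ≫ q.out _ = a ≫ q.p₂),
      q.ev _ (v ≫ m) a h₁ ≫ p.out x = q.ev _ (v ≫ m') a h₂ ≫ p.out x)
    (h : ∀ (V : E) (v : V ⟶ W) (a : V ⟶ q.A) (h₁ : (v ≫ m) ≫ q.out _ = a ≫ q.p₂)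
      (h₂ : (v ≫ m') ≫ q.out _ = a ≫ q.p₂) (a' : V ⟶ p.A)
      (h₁' : q.ev _ (v ≫ m) a h₁ ≫ p.out x = a' ≫ p.p₂)
      (h₂' : q.ev _ (v ≫ m') a h₂ ≫ p.out x = a' ≫ p.p₂),
      p.ev x (q.ev _ (v ≫ m) a h₁) a' h₁' = p.ev x (q.ev _ (v ≫ m') a h₂) a' h₂') :
    m = m' := by
  refine q.ext_ext' hm fun V v a h₁ h₂ => p.ext_ext' (hm' V v a h₁ h₂) ?_
  intro V' v' a' h₁' h₂'
  have e₁ := comp_ev q (p.leg x) v' (v ≫ m) a h₁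
  have e₂ := comp_ev q (p.leg x) v' (v ≫ m') a h₂
  have e₃ := ev_congr q (p.leg x) (Category.assoc v' v m).symm (rfl : v' ≫ a = v' ≫ a)
    (by simpa using congrArg (v' ≫ ·) h₁)
  have e₄ := ev_congr q (p.leg x) (Category.assoc v' v m').symm (rfl : v' ≫ a = v' ≫ a)
    (by simpa using congrArg (v' ≫ ·) h₂)
  have w₁ : ((v' ≫ v) ≫ m) ≫ q.out _ = (v' ≫ a) ≫ q.p₂ := by simpa using congrArg (v' ≫ ·) h₁
  have w₂ : ((v' ≫ v) ≫ m') ≫ q.out _ = (v' ≫ a) ≫ q.p₂ := by simpa using congrArg (v' ≫ ·) h₂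
  have f₁ := e₁.trans e₃
  have f₂ := e₂.trans e₄
  exact (ev_congr p x f₁ rfl _).trans ((h V' (v' ≫ v) (v' ≫ a) w₁ w₂ a' (f₁ ▸ h₁') (f₂ ▸ h₂')).trans
    (ev_congr p x f₂ rfl _).symm)

theorem ev_map' {C' : E} {x : C ⟶ X} {x' : C' ⟶ X} (t : C ⟶ C') (ht : t ≫ x' = x) {V : E}
    (n : V ⟶ p.ext x) (a : V ⟶ p.A) {n' : V ⟶ p.ext x'} {a' : V ⟶ p.A} (hn : n' = n ≫ p.map t ht)
    (ha : a' = a) (h : n' ≫ p.out x' = a' ≫ p.p₂) :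
    p.ev x' n' a' h = p.ev x n a (by rw [← ha, ← h, hn, Category.assoc, map_out]) ≫ t := by
  subst hn ha
  exact ev_map p t ht n a' h

section AssocMap

/-- A generalized element of the middle part of the evaluation of `q(p(x))`. -/
def assocAux : pullback ((comp p q).out x) (midFst p q) ⟶ p.ext x :=
  p.lift x (pullback.snd _ _ ≫ midEv p q)
    (pullback.fst (pullback.snd ((comp p q).out x) (midFst p q)) (toMid p q))
    (pullback.snd _ _ ≫ a₁ p q)
    ((IsPullback.of_hasPullback _ _).flip.paste_horiz (isPullback_top p q).flip).flip
    ((comp p q).ev x (pullback.fst _ _ ≫ pullback.fst _ _) (pullback.snd _ _)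
      (by rw [Category.assoc, pullback.condition, pullback.condition_assoc]; rfl))
    (by rw [ev_w, Category.assoc])

theorem isPullback_assocAux : IsPullback (pullback.fst ((comp p q).out x) (midFst p q))
    (pullback.snd _ _ ≫ midSnd p q) ((comp p q).out x ≫ q.out p.p₃) q.p₂ :=
  ((IsPullback.of_hasPullback _ _).flip.paste_horiz (isPullback_mid p q).flip).flip

theorem assocAux_out : assocAux p q x ≫ p.out x = pullback.snd _ _ ≫ midEv p q :=
  lift_out _ _ _ _ _ _ _ _

theorem assocAux_leg : assocAux p q x ≫ p.leg x = (pullback.snd _ _ ≫ midSnd p q) ≫ q.p₁ := by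
  rw [leg, ← Category.assoc, assocAux_out, Category.assoc, Category.assoc, midEv_w]

/-- The comparison `(q ∘ p)(x) ⟶ q(p(x))`. -/
def assocMap : (comp p q).ext x ⟶ q.ext (p.leg x) :=
  q.lift (p.leg x) ((comp p q).out x ≫ q.out p.p₃) (pullback.fst _ _)
    (pullback.snd _ _ ≫ midSnd p q) (isPullback_assocAux p q x) (assocAux p q x)
    (assocAux_leg p q x)

@[simp]
theorem assocMap_out : assocMap p q x ≫ q.out (p.leg x) = (comp p q).out x ≫ q.out p.p₃ :=
  lift_out _ _ _ _ _ _ _ _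

@[simp]
theorem assocMap_out_assoc {T : E} (k : q.B ⟶ T) :
    assocMap p q x ≫ q.out (p.leg x) ≫ k = (comp p q).out x ≫ q.out p.p₃ ≫ k := by
  rw [← Category.assoc, assocMap_out, Category.assoc]

@[simp]
theorem assocMap_leg : assocMap p q x ≫ q.leg (p.leg x) = (comp p q).leg x :=
  assocMap_out_assoc p q x q.p₃

variable {V : E}

theorem ev_assocMap (n : V ⟶ (comp p q).ext x) (m : V ⟶ mid p q)
    (h : n ≫ (comp p q).out x = m ≫ midFst p q) {n' : V ⟶ q.ext (p.leg x)} {a : V ⟶ q.A}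
    (hn : n' = n ≫ assocMap p q x) (ha : a = m ≫ midSnd p q)
    (h' : n' ≫ q.out (p.leg x) = a ≫ q.p₂) :
    q.ev (p.leg x) n' a h' = pullback.lift n m h ≫ assocAux p q x :=
  ev_lift q (p.leg x) ((comp p q).out x ≫ q.out p.p₃) (pullback.fst _ _)
    (pullback.snd _ _ ≫ midSnd p q) (isPullback_assocAux p q x) (assocAux p q x)
    (assocAux_leg p q x) (pullback.lift n m h) (by
      rw [hn, ← Category.assoc, pullback.lift_fst]; rfl)
    (by rw [ha, ← Category.assoc, pullback.lift_snd]) h'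

theorem ev_assocMap_out (n : V ⟶ (comp p q).ext x) {n' : V ⟶ q.ext (p.leg x)} (a : V ⟶ q.A)
    (hn : n' = n ≫ assocMap p q x) (h' : n' ≫ q.out (p.leg x) = a ≫ q.p₂) :
    q.ev (p.leg x) n' a h' ≫ p.out x = q.ev p.p₃ (n ≫ (comp p q).out x) a (by
      rw [← h', hn, Category.assoc, Category.assoc, assocMap_out]) := by
  have w : (n ≫ (comp p q).out x) ≫ q.out p.p₃ = a ≫ q.p₂ := by
    rw [← h', hn, Category.assoc, Category.assoc, assocMap_out]
  rw [ev_assocMap p q x n ((isPullback_mid p q).lift (n ≫ (comp p q).out x) a w)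
    (by rw [IsPullback.lift_fst]) hn (by rw [IsPullback.lift_snd]), Category.assoc, assocAux_out,
    ← Category.assoc, pullback.lift_snd, midEv, comp_ev]
  exact ev_congr _ _ (IsPullback.lift_fst _ _ _ _) (IsPullback.lift_snd _ _ _ _) _

theorem ev_ev_assocMap (n : V ⟶ (comp p q).ext x) (t : V ⟶ (comp p q).A)
    (h : n ≫ (comp p q).out x = t ≫ (comp p q).p₂) {n' : V ⟶ q.ext (p.leg x)} {a : V ⟶ q.A}
    {a' : V ⟶ p.A} (hn : n' = n ≫ assocMap p q x) (ha : a = t ≫ a₂ p q) (ha' : a' = t ≫ a₁ p q)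
    (h' : n' ≫ q.out (p.leg x) = a ≫ q.p₂) {n'' : V ⟶ p.ext x}
    (hn'' : n'' = q.ev (p.leg x) n' a h') (h'' : n'' ≫ p.out x = a' ≫ p.p₂) :
    p.ev x n'' a' h'' = (comp p q).ev x n t h := by
  have w : n ≫ (comp p q).out x = (t ≫ toMid p q) ≫ midFst p q := h.trans (Category.assoc _ _ _).symm
  have e := ev_assocMap p q x n (t ≫ toMid p q) w hn (ha.trans (Category.assoc _ _ _).symm) h'
  refine (ev_lift p x (pullback.snd _ _ ≫ midEv p q)
    (pullback.fst (pullback.snd ((comp p q).out x) (midFst p q)) (toMid p q))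
    (pullback.snd _ _ ≫ a₁ p q)
    ((IsPullback.of_hasPullback _ _).flip.paste_horiz (isPullback_top p q).flip).flip
    ((comp p q).ev x (pullback.fst _ _ ≫ pullback.fst _ _) (pullback.snd _ _)
      (by rw [Category.assoc, pullback.condition, pullback.condition_assoc]; rfl))
    (by rw [ev_w, Category.assoc]) (pullback.lift (pullback.lift n (t ≫ toMid p q) w) t
      (by rw [pullback.lift_snd])) ?_ ?_ _).trans ?_
  · rw [hn'', e, ← Category.assoc, pullback.lift_fst]; rfl
  · rw [ha', ← Category.assoc, pullback.lift_snd]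
  · rw [comp_ev]
    exact ev_congr _ _ (by simp) (by simp) _

/-- The element of `(comp p q).A` given by compatible elements of `p.A` and `q.A`. -/
def pair (m : V ⟶ q.ext p.p₃) (a : V ⟶ q.A) (h : m ≫ q.out p.p₃ = a ≫ q.p₂)
    (a' : V ⟶ p.A) (h' : q.ev p.p₃ m a h = a' ≫ p.p₂) : V ⟶ (comp p q).A :=
  (isPullback_top p q).lift ((isPullback_mid p q).lift m a h) a' (by
    rw [← h', midEv, comp_ev]
    exact ev_congr _ _ (IsPullback.lift_fst _ _ _ _) (IsPullback.lift_snd _ _ _ _) _)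

section

variable {p q}
variable (m : V ⟶ q.ext p.p₃) (a : V ⟶ q.A) (h : m ≫ q.out p.p₃ = a ≫ q.p₂)
    (a' : V ⟶ p.A) (h' : q.ev p.p₃ m a h = a' ≫ p.p₂)

theorem pair_toMid : pair p q m a h a' h' ≫ toMid p q = (isPullback_mid p q).lift m a h :=
  IsPullback.lift_fst _ _ _ _

theorem pair_a₁ : pair p q m a h a' h' ≫ a₁ p q = a' :=
  IsPullback.lift_snd _ _ _ _

theorem pair_a₂ : pair p q m a h a' h' ≫ a₂ p q = a := by
  refine (Category.assoc _ _ _).symm.trans ?_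
  rw [pair_toMid, IsPullback.lift_snd]

theorem pair_p₂ : pair p q m a h a' h' ≫ (comp p q).p₂ = m := by
  refine (Category.assoc _ _ _).symm.trans ?_
  rw [pair_toMid, IsPullback.lift_fst]

end

theorem a₂_p₂ : a₂ p q ≫ q.p₂ = (comp p q).p₂ ≫ q.out p.p₃ := by
  rw [a₂, Category.assoc, ← (isPullback_mid p q).w]
  exact (Category.assoc _ _ _).symm

theorem a₁_p₂ {n : top p q ⟶ q.ext p.p₃} (hn : n = (comp p q).p₂)
    (h : n ≫ q.out p.p₃ = a₂ p q ≫ q.p₂) :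
    q.ev p.p₃ n (a₂ p q) h = a₁ p q ≫ p.p₂ := by
  rw [← (isPullback_top p q).w, midEv, comp_ev]
  exact ev_congr _ _ hn rfl _

theorem a₁_comp_p₂ (t : V ⟶ (comp p q).A) {n : V ⟶ q.ext p.p₃} {a : V ⟶ q.A}
    (hn : n = t ≫ (comp p q).p₂) (ha : a = t ≫ a₂ p q)
    (h : n ≫ q.out p.p₃ = a ≫ q.p₂) :
    q.ev p.p₃ n a h = t ≫ a₁ p q ≫ p.p₂ := by
  subst hn ha
  rw [← a₁_p₂ p q rfl (a₂_p₂ p q).symm, comp_ev]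

theorem assocMap_natural {C' : E} {x : C ⟶ X} {x' : C' ⟶ X} (t : C ⟶ C') (ht : t ≫ x' = x) :
    (comp p q).map t ht ≫ assocMap p q x' =
      assocMap p q x ≫ q.map (p.map t ht) (map_leg p t ht) := by
  apply comp_ext_ext
  · rw [Category.assoc, Category.assoc, assocMap_out, map_out, assocMap_out, map_out_assoc]
  · intro V v a h₁ h₂
    have w : (v ≫ assocMap p q x) ≫ q.out (p.leg x) = a ≫ q.p₂ := by
      rw [← h₂]; simp
    rw [ev_assocMap_out p q x' (v ≫ (comp p q).map t ht) a (Category.assoc _ _ _).symm,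
      ev_map' q (p.map t ht) (map_leg p t ht) (v ≫ assocMap p q x) a (Category.assoc _ _ _).symm
        rfl, Category.assoc (q.ev _ _ _ _), map_out p, ev_assocMap_out p q x v a rfl]
    exact ev_congr _ _ (by simp) rfl _
  · intro V v a h₁ h₂ a' h₁' h₂'
    have w : (v ≫ assocMap p q x) ≫ q.out (p.leg x) = a ≫ q.p₂ := by
      rw [← h₂]; simp
    have e := ev_map' q (p.map t ht) (map_leg p t ht) (v ≫ assocMap p q x) a
      (Category.assoc _ _ _).symm rfl h₂
    have e' := ev_assocMap_out p q x v a rfl w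
    have u : (v ≫ (comp p q).out x) ≫ q.out p.p₃ = a ≫ q.p₂ := by
      rw [← w]; simp
    have u' : q.ev p.p₃ (v ≫ (comp p q).out x) a u = a' ≫ p.p₂ := by
      rw [← e', ← h₂', e, Category.assoc (q.ev _ _ _ _), map_out p]
    let T := pair p q _ a u a' u'
    have hT : v ≫ (comp p q).out x = T ≫ (comp p q).p₂ := (pair_p₂ ..).symm
    have hT₁ : a' = T ≫ a₁ p q := (pair_a₁ ..).symm
    have hT₂ : a = T ≫ a₂ p q := (pair_a₂ ..).symm
    rw [ev_ev_assocMap p q x' (v ≫ (comp p q).map t ht) T (by rw [Category.assoc, map_out, hT])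
      (Category.assoc _ _ _).symm hT₂ hT₁ h₁ rfl, ev_map' _ t ht v T rfl rfl,
      ev_map' p t ht (q.ev (p.leg x) (v ≫ assocMap p q x) a w) a' e rfl,
      ev_ev_assocMap p q x v T hT rfl hT₂ hT₁ w rfl]

end AssocMap

end Poly

namespace Poly

theorem lift_eq {X Y : E} (p : Poly X Y) {C : E} (x : C ⟶ X) {W V : E} (b : W ⟶ p.B) (v : V ⟶ W)
    (a : V ⟶ p.A) (hV : IsPullback v a b p.p₂) (c : V ⟶ C) (hc : c ≫ x = a ≫ p.p₁)
    {m : W ⟶ p.ext x} (hm : m ≫ p.out x = b)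
    (h : p.ev x (v ≫ m) a (by rw [Category.assoc, hm, hV.w]) = c) :
    p.lift x b v a hV c hc = m := by
  refine p.ext_ext ((lift_out ..).trans hm.symm) hV (lift_out ..).symm ?_
  exact (ev_lift p x b v a hV c hc (𝟙 _) (by simp) (by simp) _).trans
    ((Category.id_comp _).trans h.symm)

section AssocInv

variable {X Y Z : E} (p : Poly X Y) (q : Poly Y Z) {C : E} (x : C ⟶ X)

theorem assocMap_map_out : assocMap p q x ≫ q.map (p.out x) (p.out_leg x) =
    (comp p q).out x := by
  refine q.ext_ext' ?_ ?_
  · rw [Category.assoc, map_out, assocMap_out]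
  · intro V v a h₁ h₂
    rw [ev_map' q (p.out x) (p.out_leg x) (v ≫ assocMap p q x) a (Category.assoc _ _ _).symm rfl,
      ev_assocMap_out p q x v a rfl]

theorem assocInv_aux {V : E} {n : V ⟶ q.ext (p.leg x)} {t : V ⟶ (comp p q).A}
    (h : n ≫ q.map (p.out x) (p.out_leg x) = t ≫ (comp p q).p₂) :
    ∃ h' : n ≫ q.out (p.leg x) = (t ≫ a₂ p q) ≫ q.p₂,
      q.ev (p.leg x) n (t ≫ a₂ p q) h' ≫ p.out x = (t ≫ a₁ p q) ≫ p.p₂ := by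
  have h' : n ≫ q.out (p.leg x) = (t ≫ a₂ p q) ≫ q.p₂ := by
    rw [Category.assoc, a₂_p₂, ← Category.assoc, ← h, Category.assoc, map_out]
  refine ⟨h', ?_⟩
  rw [Category.assoc, ← a₁_comp_p₂ p q t h rfl (by rw [Category.assoc, map_out]; exact h')]
  exact (ev_map' q (p.out x) (p.out_leg x) n (t ≫ a₂ p q) rfl rfl _).symm

/-- The map classified by the inverse of the comparison `(q ∘ p)(x) ⟶ q(p(x))`. -/
def assocInvAux : pullback (q.map (p.out x) (p.out_leg x)) (comp p q).p₂ ⟶ C :=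
  p.ev x (q.ev (p.leg x) (pullback.fst _ _) (pullback.snd _ _ ≫ a₂ p q)
      (assocInv_aux p q x pullback.condition).choose)
    (pullback.snd _ _ ≫ a₁ p q) (assocInv_aux p q x pullback.condition).choose_spec

theorem assocInvAux_w : assocInvAux p q x ≫ x = pullback.snd _ _ ≫ (comp p q).p₁ := by
  rw [assocInvAux, ev_w, Category.assoc]

/-- The inverse of the comparison `(q ∘ p)(x) ⟶ q(p(x))`. -/
def assocInv : q.ext (p.leg x) ⟶ (comp p q).ext x :=
  (comp p q).lift x (q.map (p.out x) (p.out_leg x)) (pullback.fst _ _) (pullback.snd _ _)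
    (IsPullback.of_hasPullback _ _)
    (assocInvAux p q x) (assocInvAux_w p q x)

@[simp]
theorem assocInv_out : assocInv p q x ≫ (comp p q).out x = q.map (p.out x) (p.out_leg x) :=
  lift_out _ _ _ _ _ _ _ _

theorem ev_assocInv {V : E} (n : V ⟶ q.ext (p.leg x)) (t : V ⟶ (comp p q).A)
    (h : (n ≫ assocInv p q x) ≫ (comp p q).out x = t ≫ (comp p q).p₂)
    (h₁ : n ≫ q.out (p.leg x) = (t ≫ a₂ p q) ≫ q.p₂)
    (h₂ : q.ev (p.leg x) n (t ≫ a₂ p q) h₁ ≫ p.out x = (t ≫ a₁ p q) ≫ p.p₂) :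
    (comp p q).ev x (n ≫ assocInv p q x) t h =
      p.ev x (q.ev (p.leg x) n (t ≫ a₂ p q) h₁) (t ≫ a₁ p q) h₂ := by
  have h' : n ≫ q.map (p.out x) (p.out_leg x) = t ≫ (comp p q).p₂ := by
    rw [← assocInv_out, ← Category.assoc, h]
  refine (ev_lift (comp p q) x (q.map (p.out x) (p.out_leg x)) (pullback.fst _ _)
    (pullback.snd _ _) (IsPullback.of_hasPullback _ _) (assocInvAux p q x) (assocInvAux_w p q x)
    (pullback.lift n t h') (by rw [← Category.assoc, pullback.lift_fst]; rfl)
    (by rw [pullback.lift_snd]) h).trans ?_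
  rw [assocInvAux, comp_ev]
  refine ev_congr _ _ ?_ (by simp) _
  rw [comp_ev]
  exact ev_congr _ _ (by simp) (by simp) _

theorem assocMap_inv : assocMap p q x ≫ assocInv p q x = 𝟙 _ := by
  refine (comp p q).ext_ext' ?_ ?_
  · rw [Category.assoc, assocInv_out, assocMap_map_out, Category.id_comp]
  · intro V v t h₁ h₂
    have h : (v ≫ assocMap p q x) ≫ q.map (p.out x) (p.out_leg x) = t ≫ (comp p q).p₂ := by
      rw [← h₁, Category.assoc, Category.assoc, Category.assoc, assocInv_out]
    obtain ⟨w₁, w₂⟩ := assocInv_aux p q x h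
    rw [Category.comp_id] at h₂
    refine (ev_congr _ _ (Category.assoc _ _ _).symm rfl _).trans
      ((ev_assocInv p q x (v ≫ assocMap p q x) t _ w₁ w₂).trans
      ((ev_ev_assocMap p q x v t h₂ rfl rfl rfl w₁ rfl w₂).trans ?_))
    exact ev_congr _ _ (Category.comp_id _).symm rfl _

theorem assocInv_map : assocInv p q x ≫ assocMap p q x = 𝟙 _ := by
  apply comp_ext_ext
  · rw [Category.assoc, assocMap_out, ← Category.assoc, assocInv_out, map_out, Category.id_comp]
  · intro V v a h₁ h₂
    rw [ev_assocMap_out p q x (v ≫ assocInv p q x) a (Category.assoc _ _ _).symm]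
    exact ev_map' q (p.out x) (p.out_leg x) (v ≫ 𝟙 _) a (by simp) rfl _
  · intro V v a h₁ h₂ a' h₁' h₂'
    rw [ev_assocMap_out p q x (v ≫ assocInv p q x) a (Category.assoc _ _ _).symm] at h₁'
    let T := pair p q _ a (by rw [← h₁]; simp only [Category.assoc, assocMap_out]) a' h₁'
    have hT : (v ≫ assocInv p q x) ≫ (comp p q).out x = T ≫ (comp p q).p₂ := (pair_p₂ ..).symm
    have hT₁ : a' = T ≫ a₁ p q := (pair_a₁ ..).symm
    have hT₂ : a = T ≫ a₂ p q := (pair_a₂ ..).symm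
    rw [ev_ev_assocMap p q x (v ≫ assocInv p q x) T hT (Category.assoc _ _ _).symm hT₂ hT₁ h₁ rfl]
    obtain ⟨w₁, w₂⟩ := assocInv_aux p q x (n := v) (t := T)
      (by rw [← assocInv_out, ← Category.assoc, hT])
    rw [ev_assocInv p q x v T hT w₁ w₂]
    exact ev_congr _ _ (ev_congr _ _ (Category.comp_id _).symm hT₂.symm _) hT₁.symm _

instance : IsIso (assocMap p q x) := ⟨assocInv p q x, assocMap_inv p q x, assocInv_map p q x⟩

end AssocInv

section Unit

/-- The identity polynomial. -/
abbrev idPoly (X : E) : Poly X X := ⟨X, X, 𝟙 X, 𝟙 X, 𝟙 X, Exponentiable.id X⟩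

variable {X : E} {C : E} (x : C ⟶ X)

/-- The comparison `1_X(x) ⟶ x`. -/
def unitMap : (idPoly X).ext x ⟶ C := (idPoly X).ev x (𝟙 _) ((idPoly X).out x) (by simp)

theorem unitMap_w : unitMap x ≫ x = (idPoly X).out x :=
  (ev_w _ _ _ _ _).trans (Category.comp_id _)

theorem unitMap_leg : unitMap x ≫ x = (idPoly X).leg x :=
  (unitMap_w x).trans (Category.comp_id _).symm

theorem ev_unit {V : E} (n : V ⟶ (idPoly X).ext x) (a : V ⟶ (idPoly X).A)
    (h : n ≫ (idPoly X).out x = a ≫ (idPoly X).p₂) :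
    (idPoly X).ev x n a h = n ≫ unitMap x := by
  rw [unitMap, comp_ev]
  exact ev_congr _ _ (Category.comp_id _).symm ((Category.comp_id _).symm.trans h.symm) _

/-- The inverse of the comparison `1_X(x) ⟶ x`. -/
def unitInv : C ⟶ (idPoly X).ext x :=
  (idPoly X).lift x x (𝟙 C) x (IsPullback.of_horiz_isIso ⟨by simp⟩) (𝟙 C) (by simp)

theorem unitInv_out : unitInv x ≫ (idPoly X).out x = x := lift_out _ _ _ _ _ _ _ _

theorem unitInv_map : unitInv x ≫ unitMap x = 𝟙 _ := by
  rw [← ev_unit x (unitInv x) x ((unitInv_out x).trans (Category.comp_id _).symm)]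
  exact (ev_lift (idPoly X) x x (𝟙 C) x (IsPullback.of_horiz_isIso ⟨by simp⟩) (𝟙 C) (by simp)
    (𝟙 _) (by simp [unitInv]) (by simp) _).trans (by simp)

theorem unitMap_inv : unitMap x ≫ unitInv x = 𝟙 _ := by
  refine (idPoly X).ext_ext' ?_ ?_
  · rw [Category.assoc, unitInv_out, unitMap_w, Category.id_comp]
  · intro V v a h₁ h₂
    rw [ev_unit, ev_unit, Category.assoc, Category.assoc, unitInv_map]
    simp

instance : IsIso (unitMap x) := ⟨unitInv x, unitMap_inv x, unitInv_map x⟩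

theorem unitMap_natural {C' : E} {x : C ⟶ X} {x' : C' ⟶ X} (t : C ⟶ C') (ht : t ≫ x' = x) :
    (idPoly X).map t ht ≫ unitMap x' = unitMap x ≫ t := by
  rw [← ev_unit x' _ ((idPoly X).out x) (by simp),
    ev_map' (idPoly X) t ht (𝟙 _) ((idPoly X).out x) (by simp) rfl]
  rfl

end Unit

section Coherence

/-- An isomorphism of polynomials from isomorphisms of the components. -/
def isoMk {X Y : E} {p q : Poly X Y} (e₀ : p.A ≅ q.A) (e₁ : p.B ≅ q.B) (w₁ : e₀.hom ≫ q.p₁ = p.p₁)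
    (w₂ : e₀.hom ≫ q.p₂ = p.p₂ ≫ e₁.hom) (w₃ : e₁.hom ≫ q.p₃ = p.p₃) : p ≅ q where
  hom := ⟨e₀.hom, e₁.hom, w₁, IsPullback.of_horiz_isIso ⟨w₂⟩, w₃⟩
  inv := ⟨e₀.inv, e₁.inv, by rw [← w₁, Iso.inv_hom_id_assoc], IsPullback.of_horiz_isIso ⟨by
    rw [Iso.inv_comp_eq, ← Category.assoc, w₂, Category.assoc, Iso.hom_inv_id, Category.comp_id]⟩,
    by rw [← w₃, Iso.inv_hom_id_assoc]⟩
  hom_inv_id := hom_ext e₀.hom_inv_id e₁.hom_inv_id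
  inv_hom_id := hom_ext e₀.inv_hom_id e₁.inv_hom_id

variable {W X Y Z : E}

section Whisker

/-- Composition of a polynomial with a cartesian morphism. -/
def whiskerLeft (p : Poly X Y) {q q' : Poly Y Z} (g : q ⟶ q') : comp p q ⟶ comp p q' :=
  homComp p q' (comp p q) (toMid p q) (midFst p q) rfl (q.out p.p₃ ≫ g.f₁)
    (midSnd p q ≫ g.f₀) (isPullback_app g p.p₃) (midEv p q) (a₁ p q) (isPullback_top p q)
    (by rw [midEv_w, Category.assoc, g.w₁']) rfl (by rw [Category.assoc, g.w₃', out_leg])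

theorem whiskerLeft_f₁ (p : Poly X Y) {q q' : Poly Y Z} (g : q ⟶ q') :
    (whiskerLeft p g).f₁ = app g p.p₃ := rfl

theorem whiskerLeft_a₁ (p : Poly X Y) {q q' : Poly Y Z} (g : q ⟶ q') :
    (whiskerLeft p g).f₀ ≫ a₁ p q' = a₁ p q := homComp_f₀_a₁ ..

theorem whiskerLeft_a₂ (p : Poly X Y) {q q' : Poly Y Z} (g : q ⟶ q') :
    (whiskerLeft p g).f₀ ≫ a₂ p q' = a₂ p q ≫ g.f₀ :=
  (homComp_f₀_a₂ ..).trans (Category.assoc _ _ _).symm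

/-- Composition of a cartesian morphism with a polynomial. -/
def whiskerRight {p p' : Poly X Y} (f : p ⟶ p') (q : Poly Y Z) : comp p q ⟶ comp p' q :=
  homComp p' q (comp p q) (toMid p q) (midFst p q) rfl (q.out p.p₃) (midSnd p q)
    (isPullback_mid p q) (midEv p q ≫ f.f₁) (a₁ p q ≫ f.f₀)
    ((isPullback_top p q).flip.paste_horiz f.isPullback.flip.flip).flip
    (by rw [Category.assoc, f.w₃', midEv_w]) (by rw [Category.assoc, f.w₁']) rfl

theorem whiskerRight_f₁ {p p' : Poly X Y} (f : p ⟶ p') (q : Poly Y Z) :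
    (whiskerRight f q).f₁ = q.map f.f₁ f.w₃ := by
  exact lift_eq _ _ _ _ _ (isPullback_mid p q) _ (by rw [Category.assoc, f.w₃', midEv_w])
    (map_out q f.f₁ f.w₃)
    (ev_map q f.f₁ f.w₃ (midFst p q) (midSnd p q) (by
      rw [Category.assoc, map_out, (isPullback_mid p q).w]))

theorem whiskerRight_a₁ {p p' : Poly X Y} (f : p ⟶ p') (q : Poly Y Z) :
    (whiskerRight f q).f₀ ≫ a₁ p' q = a₁ p q ≫ f.f₀ := homComp_f₀_a₁ ..

theorem whiskerRight_a₂ {p p' : Poly X Y} (f : p ⟶ p') (q : Poly Y Z) :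
    (whiskerRight f q).f₀ ≫ a₂ p' q = a₂ p q := homComp_f₀_a₂ ..

end Whisker

section Associator

variable (p : Poly W X) (q : Poly X Y) (r : Poly Y Z)

theorem assoc_aux₁ : ∃ (h₁ : ((comp p (comp q r)).p₂ ≫ assocMap q r p.p₃) ≫ r.out (q.leg p.p₃) =
      (a₂ p (comp q r) ≫ a₂ q r) ≫ r.p₂)
    (h₂ : r.ev (q.leg p.p₃) ((comp p (comp q r)).p₂ ≫ assocMap q r p.p₃)
      (a₂ p (comp q r) ≫ a₂ q r) h₁ ≫ q.out p.p₃ = (a₂ p (comp q r) ≫ a₁ q r) ≫ q.p₂),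
      q.ev p.p₃ (r.ev (q.leg p.p₃) ((comp p (comp q r)).p₂ ≫ assocMap q r p.p₃)
      (a₂ p (comp q r) ≫ a₂ q r) h₁) (a₂ p (comp q r) ≫ a₁ q r) h₂ =
        a₁ p (comp q r) ≫ p.p₂ := by
  have h₁ : ((comp p (comp q r)).p₂ ≫ assocMap q r p.p₃) ≫ r.out (q.leg p.p₃) =
      (a₂ p (comp q r) ≫ a₂ q r) ≫ r.p₂ := by
    rw [Category.assoc, Category.assoc, assocMap_out, a₂_p₂ q r, ← Category.assoc,
      ← a₂_p₂ p (comp q r), Category.assoc]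
  have h₂ : r.ev (q.leg p.p₃) ((comp p (comp q r)).p₂ ≫ assocMap q r p.p₃)
      (a₂ p (comp q r) ≫ a₂ q r) h₁ ≫ q.out p.p₃ = (a₂ p (comp q r) ≫ a₁ q r) ≫ q.p₂ := by
    rw [ev_assocMap_out q r p.p₃ (comp p (comp q r)).p₂ _ rfl, Category.assoc _ _ q.p₂]
    exact a₁_comp_p₂ q r (a₂ p (comp q r)) (a₂_p₂ p (comp q r)).symm rfl _
  refine ⟨h₁, h₂, ?_⟩
  rw [ev_ev_assocMap q r p.p₃ (comp p (comp q r)).p₂ (a₂ p (comp q r))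
    (a₂_p₂ p (comp q r)).symm rfl rfl rfl h₁ rfl h₂]
  exact a₁_p₂ p (comp q r) rfl _

/-- The map on first objects underlying the inverse associator. -/
def assocF₀ : top p (comp q r) ⟶ top (comp p q) r :=
  pair (comp p q) r ((comp p (comp q r)).p₂ ≫ assocMap q r p.p₃)
    (a₂ p (comp q r) ≫ a₂ q r) (assoc_aux₁ p q r).choose
    (pair p q _ (a₂ p (comp q r) ≫ a₁ q r) (assoc_aux₁ p q r).choose_spec.choose
      (a₁ p (comp q r)) (assoc_aux₁ p q r).choose_spec.choose_spec) (pair_p₂ ..).symm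

theorem assocF₀_p₂ : assocF₀ p q r ≫ (comp (comp p q) r).p₂ =
    (comp p (comp q r)).p₂ ≫ assocMap q r p.p₃ := pair_p₂ ..

theorem assocF₀_a₁_a₁ : assocF₀ p q r ≫ a₁ (comp p q) r ≫ a₁ p q = a₁ p (comp q r) :=
  (Category.assoc _ _ _).symm.trans ((congrArg (· ≫ a₁ p q) (pair_a₁ ..)).trans (pair_a₁ ..))

theorem assocF₀_a₁_a₂ : assocF₀ p q r ≫ a₁ (comp p q) r ≫ a₂ p q = a₂ p (comp q r) ≫ a₁ q r :=
  (Category.assoc _ _ _).symm.trans ((congrArg (· ≫ a₂ p q) (pair_a₁ ..)).trans (pair_a₂ ..))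

theorem assocF₀_a₂ : assocF₀ p q r ≫ a₂ (comp p q) r = a₂ p (comp q r) ≫ a₂ q r := pair_a₂ ..

theorem assoc_aux₂ : ∃ (h₁ : (((comp (comp p q) r).p₂ ≫ assocInv q r p.p₃) ≫
      (comp q r).out p.p₃) ≫ r.out q.p₃ = a₂ (comp p q) r ≫ r.p₂),
    r.ev q.p₃ (((comp (comp p q) r).p₂ ≫ assocInv q r p.p₃) ≫ (comp q r).out p.p₃)
      (a₂ (comp p q) r) h₁ = (a₁ (comp p q) r ≫ a₂ p q) ≫ q.p₂ := by
  have e : (comp (comp p q) r).p₂ =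
      ((comp (comp p q) r).p₂ ≫ assocInv q r p.p₃) ≫ assocMap q r p.p₃ :=
    (Category.comp_id _).symm.trans
      ((congrArg _ (assocInv_map q r p.p₃).symm).trans (Category.assoc _ _ _).symm)
  have h₁ : (((comp (comp p q) r).p₂ ≫ assocInv q r p.p₃) ≫
      (comp q r).out p.p₃) ≫ r.out q.p₃ = a₂ (comp p q) r ≫ r.p₂ := by
    rw [a₂_p₂, Category.assoc, Category.assoc, ← assocMap_out]
    congr 1
    rw [← Category.assoc, assocInv_map, Category.id_comp]
  refine ⟨h₁, ?_⟩
  rw [← ev_assocMap_out q r p.p₃ ((comp (comp p q) r).p₂ ≫ assocInv q r p.p₃) (a₂ (comp p q) r)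
    e (a₂_p₂ (comp p q) r).symm]
  rw [a₁_p₂ (comp p q) r rfl, Category.assoc, Category.assoc, a₂_p₂]

theorem assoc_aux₃ : ∃ (h : ((comp (comp p q) r).p₂ ≫ assocInv q r p.p₃) ≫ (comp q r).out p.p₃ =
      pair q r _ (a₂ (comp p q) r) (assoc_aux₂ p q r).choose (a₁ (comp p q) r ≫ a₂ p q)
        (assoc_aux₂ p q r).choose_spec ≫ (comp q r).p₂),
    (comp q r).ev p.p₃ ((comp (comp p q) r).p₂ ≫ assocInv q r p.p₃)
      (pair q r _ (a₂ (comp p q) r) (assoc_aux₂ p q r).choose (a₁ (comp p q) r ≫ a₂ p q)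
        (assoc_aux₂ p q r).choose_spec) h = (a₁ (comp p q) r ≫ a₁ p q) ≫ p.p₂ := by
  have e : (comp (comp p q) r).p₂ =
      ((comp (comp p q) r).p₂ ≫ assocInv q r p.p₃) ≫ assocMap q r p.p₃ :=
    (Category.comp_id _).symm.trans
      ((congrArg _ (assocInv_map q r p.p₃).symm).trans (Category.assoc _ _ _).symm)
  refine ⟨(pair_p₂ ..).symm, ?_⟩
  have e' := a₁_p₂ (comp p q) r rfl (a₂_p₂ (comp p q) r).symm
  rw [← ev_ev_assocMap q r p.p₃ ((comp (comp p q) r).p₂ ≫ assocInv q r p.p₃) _ _ e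
    (pair_a₂ ..).symm (pair_a₁ ..).symm (a₂_p₂ (comp p q) r).symm e'.symm
    (by rw [Category.assoc, Category.assoc, a₂_p₂])]
  rw [a₁_comp_p₂ p q (a₁ (comp p q) r) rfl rfl, Category.assoc]

/-- The inverse of the map on first objects underlying the inverse associator. -/
def assocG₀ : top (comp p q) r ⟶ top p (comp q r) :=
  pair p (comp q r) ((comp (comp p q) r).p₂ ≫ assocInv q r p.p₃)
    (pair q r _ (a₂ (comp p q) r) (assoc_aux₂ p q r).choose (a₁ (comp p q) r ≫ a₂ p q)
        (assoc_aux₂ p q r).choose_spec) (assoc_aux₃ p q r).choose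
    (a₁ (comp p q) r ≫ a₁ p q) (assoc_aux₃ p q r).choose_spec

theorem assocG₀_p₂ : assocG₀ p q r ≫ (comp p (comp q r)).p₂ =
    (comp (comp p q) r).p₂ ≫ assocInv q r p.p₃ := pair_p₂ ..

theorem assocG₀_a₁ : assocG₀ p q r ≫ a₁ p (comp q r) = a₁ (comp p q) r ≫ a₁ p q := pair_a₁ ..

theorem assocG₀_a₂_a₁ : assocG₀ p q r ≫ a₂ p (comp q r) ≫ a₁ q r = a₁ (comp p q) r ≫ a₂ p q :=
  (Category.assoc _ _ _).symm.trans ((congrArg (· ≫ a₁ q r) (pair_a₂ ..)).trans (pair_a₁ ..))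

theorem assocG₀_a₂_a₂ : assocG₀ p q r ≫ a₂ p (comp q r) ≫ a₂ q r = a₂ (comp p q) r :=
  (Category.assoc _ _ _).symm.trans ((congrArg (· ≫ a₂ q r) (pair_a₂ ..)).trans (pair_a₂ ..))

variable {p q r}

theorem top_ext_right {T : E} {s t : T ⟶ top p (comp q r)}
    (h : s ≫ (comp p (comp q r)).p₂ = t ≫ (comp p (comp q r)).p₂)
    (h₁ : s ≫ a₁ p (comp q r) = t ≫ a₁ p (comp q r))
    (h₂ : s ≫ a₂ p (comp q r) ≫ a₁ q r = t ≫ a₂ p (comp q r) ≫ a₁ q r)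
    (h₃ : s ≫ a₂ p (comp q r) ≫ a₂ q r = t ≫ a₂ p (comp q r) ≫ a₂ q r) : s = t := by
  refine top_ext h h₁ (top_ext ?_ (by simpa using h₂) (by simpa using h₃))
  have e := a₂_p₂ p (comp q r)
  change (s ≫ _) ≫ (comp q r).p₂ = (t ≫ _) ≫ (comp q r).p₂
  rw [Category.assoc, Category.assoc, e, ← Category.assoc, h, Category.assoc]

theorem top_ext_left {T : E} {s t : T ⟶ top (comp p q) r}
    (h : s ≫ (comp (comp p q) r).p₂ = t ≫ (comp (comp p q) r).p₂)
    (h₁ : s ≫ a₁ (comp p q) r ≫ a₁ p q = t ≫ a₁ (comp p q) r ≫ a₁ p q)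
    (h₂ : s ≫ a₁ (comp p q) r ≫ a₂ p q = t ≫ a₁ (comp p q) r ≫ a₂ p q)
    (h₃ : s ≫ a₂ (comp p q) r = t ≫ a₂ (comp p q) r) : s = t := by
  refine top_ext h (top_ext ?_ (by simpa using h₁) (by simpa using h₂)) h₃
  change (s ≫ _) ≫ (comp p q).p₂ = (t ≫ _) ≫ (comp p q).p₂
  have w : (s ≫ (comp (comp p q) r).p₂) ≫ r.out (comp p q).p₃ = (s ≫ a₂ (comp p q) r) ≫ r.p₂ := by
    rw [Category.assoc, Category.assoc, a₂_p₂]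
  have w' : (t ≫ (comp (comp p q) r).p₂) ≫ r.out (comp p q).p₃ = (t ≫ a₂ (comp p q) r) ≫ r.p₂ := by
    rw [Category.assoc, Category.assoc, a₂_p₂]
  rw [Category.assoc, Category.assoc, ← a₁_comp_p₂ (comp p q) r s rfl rfl w,
    ← a₁_comp_p₂ (comp p q) r t rfl rfl w']
  exact ev_congr _ _ h h₃ _

variable (p q r)

/-- The associator of composition of polynomials. -/
def associator : comp (comp p q) r ≅ comp p (comp q r) :=
  (isoMk (p := comp p (comp q r)) (q := comp (comp p q) r)
    ⟨assocF₀ p q r, assocG₀ p q r,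
      top_ext_right
        (by rw [Category.assoc, assocG₀_p₂, ← Category.assoc, assocF₀_p₂, Category.assoc,
          assocMap_inv, Category.comp_id, Category.id_comp])
        (by rw [Category.assoc, assocG₀_a₁, assocF₀_a₁_a₁, Category.id_comp])
        (by rw [Category.assoc, assocG₀_a₂_a₁, assocF₀_a₁_a₂, Category.id_comp])
        (by rw [Category.assoc, assocG₀_a₂_a₂, assocF₀_a₂, Category.id_comp]),
      top_ext_left
        (by rw [Category.assoc, assocF₀_p₂, ← Category.assoc, assocG₀_p₂, Category.assoc,
          assocInv_map, Category.id_comp]; exact Category.comp_id _)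
        (by rw [Category.assoc, assocF₀_a₁_a₁, assocG₀_a₁, Category.id_comp])
        (by rw [Category.assoc, assocF₀_a₁_a₂, assocG₀_a₂_a₁, Category.id_comp])
        (by rw [Category.assoc, assocF₀_a₂, assocG₀_a₂_a₂, Category.id_comp])⟩
    (asIso (assocMap q r p.p₃))
    (by
      have := congrArg (· ≫ p.p₁) (assocF₀_a₁_a₁ p q r)
      simpa using this)
    (assocF₀_p₂ p q r)
    (assocMap_leg q r p.p₃)).symm

end Associator

end Coherence

end Poly

namespace Poly

section Unitors

variable {X Y : E} (p : Poly X Y)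

theorem out_id_inv : ∃ s : p.B ⟶ p.ext (𝟙 X), s ≫ p.out (𝟙 X) = 𝟙 _ ∧ p.out (𝟙 X) ≫ s = 𝟙 _ := by
  have hs : p.lift (𝟙 X) (𝟙 p.B) p.p₂ (𝟙 p.A) (IsPullback.of_vert_isIso ⟨by simp⟩) p.p₁ (by simp) ≫
    p.out (𝟙 X) = 𝟙 _ := lift_out ..
  refine ⟨_, hs, ?_⟩
  refine p.ext_ext' ?_ ?_
  · rw [Category.assoc, hs, Category.comp_id, Category.id_comp]
  · intro V v a h₁ h₂
    rw [← Category.comp_id (p.ev _ _ _ h₁), ← Category.comp_id (p.ev _ _ _ h₂), ev_w, ev_w]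

instance : IsIso (p.out (𝟙 X)) := by
  obtain ⟨s, h₁, h₂⟩ := out_id_inv p
  exact ⟨s, h₂, h₁⟩

theorem leftUnitor_aux : ∃ (h : (p.p₂ ≫ inv (p.out (𝟙 X))) ≫ p.out (idPoly X).p₃ = 𝟙 p.A ≫ p.p₂),
    p.ev (idPoly X).p₃ (p.p₂ ≫ inv (p.out (𝟙 X))) (𝟙 p.A) h = p.p₁ ≫ (idPoly X).p₂ := by
  have h : (p.p₂ ≫ inv (p.out (𝟙 X))) ≫ p.out (idPoly X).p₃ = 𝟙 p.A ≫ p.p₂ := by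
    change (p.p₂ ≫ inv (p.out (𝟙 X))) ≫ p.out (𝟙 X) = _
    simp
  refine ⟨h, ?_⟩
  have := ev_w p (𝟙 X) _ _ h
  rw [Category.comp_id, Category.id_comp] at this
  exact this.trans (Category.comp_id _).symm

/-- The left unitor of composition of polynomials. -/
def leftUnitor : comp (idPoly X) p ≅ p :=
  isoMk (p := comp (idPoly X) p) (q := p)
    ⟨a₂ (idPoly X) p,
      pair (idPoly X) p (p.p₂ ≫ inv (p.out (𝟙 X))) (𝟙 p.A) (leftUnitor_aux p).choose p.p₁
        (leftUnitor_aux p).choose_spec,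
      top_ext
        (by
          change (_ ≫ _) ≫ (comp (idPoly X) p).p₂ = _ ≫ (comp (idPoly X) p).p₂
          rw [Category.assoc, pair_p₂, ← Category.assoc, a₂_p₂, Category.id_comp]
          change (_ ≫ p.out (𝟙 X)) ≫ _ = _
          rw [Category.assoc, IsIso.hom_inv_id, Category.comp_id])
        (by
          rw [Category.assoc, pair_a₁, Category.id_comp]
          have h₁ := a₁_p₂ (idPoly X) p rfl (a₂_p₂ _ _).symm
          have h₂ := ev_w p (𝟙 X) _ _ (a₂_p₂ (idPoly X) p).symm
          rw [Category.comp_id] at h₁ h₂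
          exact h₂.symm.trans h₁)
        (by rw [Category.assoc, pair_a₂, Category.id_comp, Category.comp_id]),
      pair_a₂ ..⟩
    (asIso (p.out (𝟙 X)))
    (by
      have h₁ := a₁_p₂ (idPoly X) p rfl (a₂_p₂ _ _).symm
      have h₂ := ev_w p (𝟙 X) _ _ (a₂_p₂ (idPoly X) p).symm
      rw [Category.comp_id] at h₁ h₂
      exact h₂.symm.trans (h₁.trans (Category.comp_id _).symm))
    (a₂_p₂ ..) (out_leg ..)

theorem leftUnitor_f₁ : (leftUnitor p).hom.f₁ = p.out (𝟙 X) := rfl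

theorem leftUnitor_f₀ : (leftUnitor p).hom.f₀ = a₂ (idPoly X) p := rfl

theorem rightUnitor_aux : ∃ (h : (p.p₂ ≫ unitInv p.p₃) ≫ (idPoly Y).out p.p₃ =
      (p.p₂ ≫ p.p₃) ≫ (idPoly Y).p₂),
    (idPoly Y).ev p.p₃ (p.p₂ ≫ unitInv p.p₃) (p.p₂ ≫ p.p₃) h = 𝟙 p.A ≫ p.p₂ := by
  refine ⟨by rw [Category.assoc, unitInv_out, Category.comp_id], ?_⟩
  rw [ev_unit, Category.assoc, unitInv_map, Category.comp_id, Category.id_comp]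

theorem bot_unitMap : (comp p (idPoly Y)).p₂ ≫ unitMap p.p₃ = a₁ p (idPoly Y) ≫ p.p₂ := by
  rw [← a₁_p₂ p (idPoly Y) rfl (a₂_p₂ _ _).symm, ev_unit]

/-- The right unitor of composition of polynomials. -/
def rightUnitor : comp p (idPoly Y) ≅ p :=
  isoMk (p := comp p (idPoly Y)) (q := p)
    ⟨a₁ p (idPoly Y),
      pair p (idPoly Y) (p.p₂ ≫ unitInv p.p₃) (p.p₂ ≫ p.p₃) (rightUnitor_aux p).choose (𝟙 p.A)
        (rightUnitor_aux p).choose_spec,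
      top_ext
        (by
          change (_ ≫ _) ≫ (comp p (idPoly Y)).p₂ = _ ≫ (comp p (idPoly Y)).p₂
          rw [Category.assoc, pair_p₂, ← Category.assoc, ← bot_unitMap, Category.assoc,
            unitMap_inv, Category.comp_id, Category.id_comp])
        (by rw [Category.assoc, pair_a₁, Category.id_comp, Category.comp_id])
        (by
          have e := a₂_p₂ p (idPoly Y)
          rw [Category.comp_id] at e
          rw [Category.assoc, pair_a₂, Category.id_comp, e, ← unitMap_w, ← Category.assoc,
            ← Category.assoc, bot_unitMap]),
      pair_a₁ ..⟩
    (asIso (unitMap p.p₃)) rfl (bot_unitMap p).symm (unitMap_leg p.p₃)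

theorem rightUnitor_f₁ : (rightUnitor p).hom.f₁ = unitMap p.p₃ := rfl

theorem rightUnitor_f₀ : (rightUnitor p).hom.f₀ = a₁ p (idPoly Y) := rfl

end Unitors

section Laws

variable {W X Y Z : E}

theorem app_whiskerLeft (p : Poly X Y) {q q' : Poly Y Z} (g : q ⟶ q') {C : E} (x : C ⟶ X) :
    app (whiskerLeft p g) x ≫ assocMap p q' x = assocMap p q x ≫ app g (p.leg x) := by
  have o : (app (whiskerLeft p g) x ≫ assocMap p q' x) ≫ q'.out _ =
      (comp p q).out x ≫ q.out p.p₃ ≫ g.f₁ := by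
    rw [Category.assoc, assocMap_out, app_out_assoc, whiskerLeft_f₁, app_out]
  have lem {V : E} (v : V ⟶ (comp p q).ext x) (a : V ⟶ q'.A)
      (h₁ : (v ≫ app (whiskerLeft p g) x ≫ assocMap p q' x) ≫ q'.out _ = a ≫ q'.p₂) :
      ∃ b : V ⟶ q.A, b ≫ g.f₀ = a ∧ b ≫ q.p₂ = (v ≫ assocMap p q x) ≫ q.out _ := by
    have w : a ≫ q'.p₂ = (v ≫ (comp p q).out x ≫ q.out p.p₃) ≫ g.f₁ := by
      rw [← h₁, Category.assoc, o]; simp only [Category.assoc]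
    refine ⟨g.isPullback.lift a _ w, g.isPullback.lift_fst _ _ _, ?_⟩
    rw [g.isPullback.lift_snd, Category.assoc, assocMap_out]
  apply comp_ext_ext
  · rw [o, Category.assoc, app_out, assocMap_out_assoc]
  · intro V v a h₁ h₂
    obtain ⟨b, rfl, hb⟩ := lem v a h₁
    rw [ev_assocMap_out p q' x (v ≫ app (whiskerLeft p g) x) _ (Category.assoc _ _ _).symm,
      ev_app g (p.leg x) (v ≫ assocMap p q x) b hb.symm (Category.assoc _ _ _).symm rfl,
      ev_assocMap_out p q x v b rfl]
    exact ev_app g p.p₃ (v ≫ (comp p q).out x) b (by rw [hb]; simp) (by simp [whiskerLeft_f₁])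
      rfl _
  · intro V v a h₁ h₂ a' h₁' h₂'
    obtain ⟨b, rfl, hb⟩ := lem v a h₁
    have e := ev_app g (p.leg x) (v ≫ assocMap p q x) b hb.symm (Category.assoc _ _ _).symm rfl h₂
    have u : (v ≫ (comp p q).out x) ≫ q.out p.p₃ = b ≫ q.p₂ := by rw [hb]; simp
    have u' : q.ev p.p₃ (v ≫ (comp p q).out x) b u = a' ≫ p.p₂ := by
      rw [← ev_assocMap_out p q x v b rfl hb.symm, ← e, h₂']
    let T := pair p q _ b u a' u'
    have hT : v ≫ (comp p q).out x = T ≫ (comp p q).p₂ := (pair_p₂ ..).symm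
    have hT₁ : a' = T ≫ a₁ p q := (pair_a₁ ..).symm
    have hT₂ : b = T ≫ a₂ p q := (pair_a₂ ..).symm
    have k := (whiskerLeft p g).w₂
    rw [ev_congr p x e rfl, ev_ev_assocMap p q x v T hT rfl hT₂ hT₁ hb.symm rfl,
      ev_ev_assocMap p q' x (v ≫ app (whiskerLeft p g) x) (T ≫ (whiskerLeft p g).f₀)
        (by rw [Category.assoc, app_out, Category.assoc, k, ← Category.assoc, hT, Category.assoc])
        (Category.assoc _ _ _).symm (by rw [Category.assoc, whiskerLeft_a₂, hT₂, Category.assoc])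
        (by rw [Category.assoc, whiskerLeft_a₁, hT₁]) h₁ rfl]
    exact ev_app (whiskerLeft p g) x v T hT rfl rfl _

theorem app_whiskerRight {p p' : Poly X Y} (f : p ⟶ p') (q : Poly Y Z) {C : E} (x : C ⟶ X) :
    app (whiskerRight f q) x ≫ assocMap p' q x =
      assocMap p q x ≫ q.map (app f x) (app_leg f x) := by
  have o : (app (whiskerRight f q) x ≫ assocMap p' q x) ≫ q.out _ =
      (comp p q).out x ≫ q.out p.p₃ := by
    rw [Category.assoc, assocMap_out, app_out_assoc, whiskerRight_f₁, map_out]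
  apply comp_ext_ext
  · rw [o, Category.assoc, map_out, assocMap_out]
  · intro V v a h₁ h₂
    have w : (v ≫ assocMap p q x) ≫ q.out _ = a ≫ q.p₂ := by
      rw [← h₁, Category.assoc, Category.assoc, o, assocMap_out]
    rw [ev_assocMap_out p' q x (v ≫ app (whiskerRight f q) x) _ (Category.assoc _ _ _).symm,
      ev_map' q (app f x) (app_leg f x) (v ≫ assocMap p q x) a (Category.assoc _ _ _).symm rfl,
      Category.assoc (q.ev _ _ _ _), app_out, ← Category.assoc (q.ev _ _ _ _),
      ev_assocMap_out p q x v a rfl]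
    exact ev_map' q f.f₁ f.w₃ (v ≫ (comp p q).out x) a (by simp [whiskerRight_f₁]) rfl _
  · intro V v a h₁ h₂ a' h₁' h₂'
    have w : (v ≫ assocMap p q x) ≫ q.out _ = a ≫ q.p₂ := by
      rw [← h₁, Category.assoc, Category.assoc, o, assocMap_out]
    have e := ev_map' q (app f x) (app_leg f x) (v ≫ assocMap p q x) a (Category.assoc _ _ _).symm
      rfl h₂
    have e' := ev_assocMap_out p q x v a rfl w
    have u : (v ≫ (comp p q).out x) ≫ q.out p.p₃ = a ≫ q.p₂ := by rw [← w]; simp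
    have j : a' ≫ p'.p₂ = q.ev p.p₃ (v ≫ (comp p q).out x) a u ≫ f.f₁ := by
      rw [← h₂', e, Category.assoc (q.ev _ _ _ _), app_out, ← Category.assoc (q.ev _ _ _ _), e']
    let b := f.isPullback.lift a' _ j
    have hb : b ≫ f.f₀ = a' := f.isPullback.lift_fst _ _ _
    have u' : q.ev p.p₃ (v ≫ (comp p q).out x) a u = b ≫ p.p₂ :=
      (f.isPullback.lift_snd _ _ _).symm
    let T := pair p q _ a u b u'
    have hT : v ≫ (comp p q).out x = T ≫ (comp p q).p₂ := (pair_p₂ ..).symm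
    have hT₁ : b = T ≫ a₁ p q := (pair_a₁ ..).symm
    have hT₂ : a = T ≫ a₂ p q := (pair_a₂ ..).symm
    have k := (whiskerRight f q).w₂
    rw [ev_app f x (q.ev (p.leg x) (v ≫ assocMap p q x) a w) b (e'.trans u') e hb.symm,
      ev_ev_assocMap p q x v T hT rfl hT₂ hT₁ w rfl,
      ev_ev_assocMap p' q x (v ≫ app (whiskerRight f q) x) (T ≫ (whiskerRight f q).f₀)
        (by rw [Category.assoc, app_out, Category.assoc, k, ← Category.assoc, hT, Category.assoc])
        (Category.assoc _ _ _).symm (by rw [Category.assoc, whiskerRight_a₂, hT₂])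
        (by rw [Category.assoc, whiskerRight_a₁, ← hb, ← Category.assoc, ← hT₁]) h₁ rfl]
    exact ev_app (whiskerRight f q) x v T hT rfl rfl _

theorem app_leftUnitor (p : Poly X Y) {C : E} (x : C ⟶ X) :
    app (leftUnitor p).hom x = assocMap (idPoly X) p x ≫ p.map (unitMap x) (unitMap_leg x) := by
  refine p.ext_ext' ?_ ?_
  · rw [app_out, leftUnitor_f₁, Category.assoc, map_out, assocMap_out]
  · intro V v a h₁ h₂
    have j : a ≫ p.p₂ = (v ≫ (comp (idPoly X) p).out x) ≫ (leftUnitor p).hom.f₁ := by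
      rw [← h₁, Category.assoc, app_out, Category.assoc]
    let T := (leftUnitor p).hom.isPullback.lift a _ j
    have hT : v ≫ (comp (idPoly X) p).out x = T ≫ (comp (idPoly X) p).p₂ :=
      ((leftUnitor p).hom.isPullback.lift_snd _ _ _).symm
    have hT₂ : a = T ≫ a₂ (idPoly X) p := ((leftUnitor p).hom.isPullback.lift_fst _ _ _).symm
    have w : (v ≫ assocMap (idPoly X) p x) ≫ p.out _ = a ≫ p.p₂ := by
      rw [← h₂, Category.assoc, Category.assoc, Category.assoc, map_out]
    have w' : p.ev _ (v ≫ assocMap (idPoly X) p x) a w ≫ (idPoly X).out x =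
        (T ≫ a₁ (idPoly X) p) ≫ (idPoly X).p₂ := by
      rw [ev_assocMap_out (idPoly X) p x v a rfl, Category.assoc T]
      exact a₁_comp_p₂ (idPoly X) p T hT hT₂ _
    rw [ev_app (leftUnitor p).hom x v T hT rfl hT₂,
      ev_map' p (unitMap x) (unitMap_leg x) (v ≫ assocMap (idPoly X) p x) a
        (Category.assoc _ _ _).symm rfl,
      ← ev_unit x _ _ w', ev_ev_assocMap (idPoly X) p x v T hT rfl hT₂ rfl w rfl]

theorem app_rightUnitor (p : Poly X Y) {C : E} (x : C ⟶ X) :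
    app (rightUnitor p).hom x = assocMap p (idPoly Y) x ≫ unitMap (p.leg x) := by
  have e {V : E} (n : V ⟶ (comp p (idPoly Y)).ext x) (a : V ⟶ Y)
      (w : (n ≫ assocMap p (idPoly Y) x) ≫ (idPoly Y).out _ = a ≫ (idPoly Y).p₂) :
      n ≫ assocMap p (idPoly Y) x ≫ unitMap (p.leg x) =
      (idPoly Y).ev (p.leg x) (n ≫ assocMap p (idPoly Y) x) a w := by
    rw [ev_unit, Category.assoc]
  have w₀ : (𝟙 _ ≫ assocMap p (idPoly Y) x) ≫ (idPoly Y).out _ =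
    (assocMap p (idPoly Y) x ≫ (idPoly Y).out _) ≫ (idPoly Y).p₂ := by simp
  refine p.ext_ext' ?_ ?_
  · rw [app_out, rightUnitor_f₁, ← Category.id_comp (assocMap _ _ _ ≫ _), e _ _ w₀,
      ev_assocMap_out p (idPoly Y) x (𝟙 _) _ rfl, ev_unit, Category.id_comp]
  · intro V v a h₁ h₂
    have j : a ≫ p.p₂ = (v ≫ (comp p (idPoly Y)).out x) ≫ (rightUnitor p).hom.f₁ := by
      rw [← h₁, Category.assoc, app_out, Category.assoc]
    let T := (rightUnitor p).hom.isPullback.lift a _ j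
    have hT : v ≫ (comp p (idPoly Y)).out x = T ≫ (comp p (idPoly Y)).p₂ :=
      ((rightUnitor p).hom.isPullback.lift_snd _ _ _).symm
    have hT₁ : a = T ≫ a₁ p (idPoly Y) := ((rightUnitor p).hom.isPullback.lift_fst _ _ _).symm
    have w : (v ≫ assocMap p (idPoly Y) x) ≫ (idPoly Y).out _ =
        (T ≫ a₂ p (idPoly Y)) ≫ (idPoly Y).p₂ := by
      rw [Category.assoc, assocMap_out, ← Category.assoc, hT, Category.assoc, ← a₂_p₂,
        Category.assoc]
    rw [ev_app (rightUnitor p).hom x v T hT rfl hT₁]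
    exact (ev_ev_assocMap p (idPoly Y) x v T hT rfl rfl hT₁ w (e v _ w) h₂).symm

theorem comp_comp_ext_ext {p : Poly W X} {q : Poly X Y} {r : Poly Y Z} {C : E} {x : C ⟶ W} {S : E}
    {m m' : S ⟶ r.ext (q.leg (p.leg x))} (hm : m ≫ r.out _ = m' ≫ r.out _)
    (hq : ∀ (V : E) (v : V ⟶ S) (a : V ⟶ r.A) (h₁ : (v ≫ m) ≫ r.out _ = a ≫ r.p₂)
      (h₂ : (v ≫ m') ≫ r.out _ = a ≫ r.p₂),
      r.ev _ (v ≫ m) a h₁ ≫ q.out _ = r.ev _ (v ≫ m') a h₂ ≫ q.out _)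
    (hp : ∀ (V : E) (v : V ⟶ S) (a : V ⟶ r.A) (h₁ : (v ≫ m) ≫ r.out _ = a ≫ r.p₂)
      (h₂ : (v ≫ m') ≫ r.out _ = a ≫ r.p₂) (a' : V ⟶ q.A)
      (h₁' : r.ev _ (v ≫ m) a h₁ ≫ q.out _ = a' ≫ q.p₂)
      (h₂' : r.ev _ (v ≫ m') a h₂ ≫ q.out _ = a' ≫ q.p₂),
      q.ev _ (r.ev _ (v ≫ m) a h₁) a' h₁' ≫ p.out x =
        q.ev _ (r.ev _ (v ≫ m') a h₂) a' h₂' ≫ p.out x)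
    (h : ∀ (V : E) (v : V ⟶ S) (a : V ⟶ r.A) (h₁ : (v ≫ m) ≫ r.out _ = a ≫ r.p₂)
      (h₂ : (v ≫ m') ≫ r.out _ = a ≫ r.p₂) (a' : V ⟶ q.A)
      (h₁' : r.ev _ (v ≫ m) a h₁ ≫ q.out _ = a' ≫ q.p₂)
      (h₂' : r.ev _ (v ≫ m') a h₂ ≫ q.out _ = a' ≫ q.p₂) (a'' : V ⟶ p.A)
      (h₁'' : q.ev _ (r.ev _ (v ≫ m) a h₁) a' h₁' ≫ p.out x = a'' ≫ p.p₂)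
      (h₂'' : q.ev _ (r.ev _ (v ≫ m') a h₂) a' h₂' ≫ p.out x = a'' ≫ p.p₂),
      p.ev x (q.ev _ (r.ev _ (v ≫ m) a h₁) a' h₁') a'' h₁'' =
        p.ev x (q.ev _ (r.ev _ (v ≫ m') a h₂) a' h₂') a'' h₂'') :
    m = m' := by
  refine comp_ext_ext _ _ _ hm hq fun V v a h₁ h₂ a' h₁' h₂' =>
    p.ext_ext' (hp V v a h₁ h₂ a' h₁' h₂') ?_
  intro V' v' a'' h₁'' h₂''
  have key (k : S ⟶ r.ext (q.leg (p.leg x))) (w : (v ≫ k) ≫ r.out _ = a ≫ r.p₂)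
      (w' : r.ev _ (v ≫ k) a w ≫ q.out _ = a' ≫ q.p₂) :
      ∃ (z : ((v' ≫ v) ≫ k) ≫ r.out _ = (v' ≫ a) ≫ r.p₂)
        (z' : r.ev _ ((v' ≫ v) ≫ k) (v' ≫ a) z ≫ q.out _ = (v' ≫ a') ≫ q.p₂),
        v' ≫ q.ev _ (r.ev _ (v ≫ k) a w) a' w' =
          q.ev _ (r.ev _ ((v' ≫ v) ≫ k) (v' ≫ a) z) (v' ≫ a') z' := by
    have z : ((v' ≫ v) ≫ k) ≫ r.out _ = (v' ≫ a) ≫ r.p₂ := by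
      rw [Category.assoc v', Category.assoc v', w, Category.assoc]
    have e : v' ≫ r.ev _ (v ≫ k) a w = r.ev _ ((v' ≫ v) ≫ k) (v' ≫ a) z :=
      (comp_ev _ _ _ _ _ _).trans (ev_congr _ _ (Category.assoc _ _ _).symm rfl _)
    refine ⟨z, ?_, ?_⟩
    · rw [← e, Category.assoc, w', Category.assoc]
    · exact (comp_ev _ _ _ _ _ _).trans (ev_congr _ _ e rfl _)
  obtain ⟨z₁, z₁', e₁⟩ := key m h₁ h₁'
  obtain ⟨z₂, z₂', e₂⟩ := key m' h₂ h₂'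
  exact (ev_congr p x e₁ rfl _).trans ((h V' (v' ≫ v) (v' ≫ a) z₁ z₂ (v' ≫ a') z₁' z₂' a''
    (e₁ ▸ h₁'') (e₂ ▸ h₂'')).trans (ev_congr p x e₂ rfl _).symm)

theorem app_associator_inv (p : Poly W X) (q : Poly X Y) (r : Poly Y Z) {C : E} (x : C ⟶ W) :
    app (associator p q r).inv x ≫ assocMap (comp p q) r x ≫
      r.map (assocMap p q x) (assocMap_leg p q x) =
    assocMap p (comp q r) x ≫ assocMap q r (p.leg x) := by
  have f₁ : (associator p q r).inv.f₁ = assocMap q r p.p₃ := rfl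
  have f₀ : (associator p q r).inv.f₀ = assocF₀ p q r := rfl
  have o₁ : (app (associator p q r).inv x ≫ assocMap (comp p q) r x ≫
      r.map (assocMap p q x) (assocMap_leg p q x)) ≫ r.out _ =
      (comp p (comp q r)).out x ≫ (comp q r).out p.p₃ ≫ r.out q.p₃ := by
    rw [Category.assoc, Category.assoc, map_out, assocMap_out, app_out_assoc, f₁, assocMap_out]
  have o₂ : (assocMap p (comp q r) x ≫ assocMap q r (p.leg x)) ≫ r.out _ =
      (comp p (comp q r)).out x ≫ (comp q r).out p.p₃ ≫ r.out q.p₃ := by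
    rw [Category.assoc, assocMap_out, assocMap_out_assoc]
  -- evaluations of both sides
  have wS {V : E} (v : V ⟶ (comp p (comp q r)).ext x) (a : V ⟶ r.A)
      (h₂ : (v ≫ assocMap p (comp q r) x ≫ assocMap q r (p.leg x)) ≫ r.out _ = a ≫ r.p₂) :
      ((v ≫ (comp p (comp q r)).out x) ≫ (comp q r).out p.p₃) ≫ r.out q.p₃ = a ≫ r.p₂ := by
    rw [← h₂, Category.assoc v _ (r.out _), o₂]; simp only [Category.assoc]
  have wA {V : E} (v : V ⟶ (comp p (comp q r)).ext x) (a : V ⟶ r.A)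
      (h₂ : (v ≫ assocMap p (comp q r) x ≫ assocMap q r (p.leg x)) ≫ r.out _ = a ≫ r.p₂) :
      ((v ≫ app (associator p q r).inv x) ≫ assocMap (comp p q) r x) ≫ r.out _ = a ≫ r.p₂ := by
    rw [← h₂, Category.assoc v _ (r.out _), o₂, ← o₁]; simp only [Category.assoc, map_out]
  have eA {V : E} (v : V ⟶ (comp p (comp q r)).ext x) (a : V ⟶ r.A)
      (h₁ : (v ≫ app (associator p q r).inv x ≫ assocMap (comp p q) r x ≫
        r.map (assocMap p q x) (assocMap_leg p q x)) ≫ r.out _ = a ≫ r.p₂)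
      (w : ((v ≫ app (associator p q r).inv x) ≫ assocMap (comp p q) r x) ≫ r.out _ =
        a ≫ r.p₂) :
      r.ev _ (v ≫ app (associator p q r).inv x ≫ assocMap (comp p q) r x ≫
        r.map (assocMap p q x) (assocMap_leg p q x)) a h₁ = r.ev _ _ a w ≫ assocMap p q x :=
    ev_map' r (assocMap p q x) (assocMap_leg p q x) _ a (by simp only [Category.assoc]) rfl _
  have wM {V : E} (v : V ⟶ (comp p (comp q r)).ext x) (a : V ⟶ r.A)
      (w : ((v ≫ app (associator p q r).inv x) ≫ assocMap (comp p q) r x) ≫ r.out _ =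
        a ≫ r.p₂) :
      ((v ≫ (comp p (comp q r)).out x) ≫ assocMap q r p.p₃) ≫ r.out _ = a ≫ r.p₂ := by
    rw [← w]; simp only [Category.assoc, assocMap_out, app_out_assoc, f₁]
  have eM {V : E} (v : V ⟶ (comp p (comp q r)).ext x) (a : V ⟶ r.A)
      (w : ((v ≫ app (associator p q r).inv x) ≫ assocMap (comp p q) r x) ≫ r.out _ =
        a ≫ r.p₂)
      (w' : ((v ≫ (comp p (comp q r)).out x) ≫ assocMap q r p.p₃) ≫ r.out _ = a ≫ r.p₂) :
      r.ev _ ((v ≫ app (associator p q r).inv x) ≫ assocMap (comp p q) r x) a w ≫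
        (comp p q).out x =
      r.ev _ ((v ≫ (comp p (comp q r)).out x) ≫ assocMap q r p.p₃) a w' := by
    rw [ev_assocMap_out (comp p q) r x _ a rfl w]
    exact ev_congr _ _ (by simp only [Category.assoc, app_out, f₁]) rfl _
  have eQ {V : E} (v : V ⟶ (comp p (comp q r)).ext x) (a : V ⟶ r.A)
      (w' : ((v ≫ (comp p (comp q r)).out x) ≫ assocMap q r p.p₃) ≫ r.out _ = a ≫ r.p₂)
      (w'' : ((v ≫ (comp p (comp q r)).out x) ≫ (comp q r).out p.p₃) ≫ r.out q.p₃ = a ≫ r.p₂) :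
      r.ev _ ((v ≫ (comp p (comp q r)).out x) ≫ assocMap q r p.p₃) a w' ≫ q.out _ =
      r.ev _ ((v ≫ (comp p (comp q r)).out x) ≫ (comp q r).out p.p₃) a w'' :=
    ev_assocMap_out q r p.p₃ _ a rfl w'
  have eR {V : E} (v : V ⟶ (comp p (comp q r)).ext x) (a : V ⟶ r.A)
      (h₂ : (v ≫ assocMap p (comp q r) x ≫ assocMap q r (p.leg x)) ≫ r.out _ = a ≫ r.p₂)
      (w'' : ((v ≫ (comp p (comp q r)).out x) ≫ (comp q r).out p.p₃) ≫ r.out q.p₃ = a ≫ r.p₂) :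
      r.ev _ (v ≫ assocMap p (comp q r) x ≫ assocMap q r (p.leg x)) a h₂ ≫ q.out _ =
      r.ev _ ((v ≫ (comp p (comp q r)).out x) ≫ (comp q r).out p.p₃) a w'' := by
    rw [ev_assocMap_out q r (p.leg x) (v ≫ assocMap p (comp q r) x) a (Category.assoc _ _ _).symm]
    exact ev_congr _ _ (by simp only [Category.assoc, assocMap_out]) rfl _
  have T {V : E} (v : V ⟶ (comp p (comp q r)).ext x) (a : V ⟶ r.A) (a' : V ⟶ q.A)
      (w'' : ((v ≫ (comp p (comp q r)).out x) ≫ (comp q r).out p.p₃) ≫ r.out q.p₃ = a ≫ r.p₂)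
      (z : r.ev _ ((v ≫ (comp p (comp q r)).out x) ≫ (comp q r).out p.p₃) a w'' = a' ≫ q.p₂) :
      ∃ t : V ⟶ (comp q r).A, t ≫ a₁ q r = a' ∧ t ≫ a₂ q r = a ∧
        (v ≫ (comp p (comp q r)).out x) ≫ (comp q r).out p.p₃ = t ≫ (comp q r).p₂ :=
    ⟨pair q r _ a w'' a' z, pair_a₁ .., pair_a₂ .., (pair_p₂ ..).symm⟩
  have LP {V : E} (v : V ⟶ (comp p (comp q r)).ext x) (a : V ⟶ r.A)
      (h₁ : (v ≫ app (associator p q r).inv x ≫ assocMap (comp p q) r x ≫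
        r.map (assocMap p q x) (assocMap_leg p q x)) ≫ r.out _ = a ≫ r.p₂) (a' : V ⟶ q.A)
      (h₁' : r.ev _ (v ≫ app (associator p q r).inv x ≫ assocMap (comp p q) r x ≫
        r.map (assocMap p q x) (assocMap_leg p q x)) a h₁ ≫ q.out _ = a' ≫ q.p₂)
      (w : ((v ≫ app (associator p q r).inv x) ≫ assocMap (comp p q) r x) ≫ r.out _ = a ≫ r.p₂)
      (w' : ((v ≫ (comp p (comp q r)).out x) ≫ assocMap q r p.p₃) ≫ r.out _ = a ≫ r.p₂)
      (t : V ⟶ (comp q r).A) (ht₁ : t ≫ a₁ q r = a') (ht₂ : t ≫ a₂ q r = a)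
      (htp : (v ≫ (comp p (comp q r)).out x) ≫ (comp q r).out p.p₃ = t ≫ (comp q r).p₂) :
      q.ev _ (r.ev _ (v ≫ app (associator p q r).inv x ≫ assocMap (comp p q) r x ≫
        r.map (assocMap p q x) (assocMap_leg p q x)) a h₁) a' h₁' ≫ p.out x =
      (comp q r).ev p.p₃ (v ≫ (comp p (comp q r)).out x) t htp := by
    rw [ev_assocMap_out p q x _ a' (eA v a h₁ w) h₁']
    refine (ev_congr _ _ (eM v a w w') rfl _).trans ?_
    exact ev_ev_assocMap q r p.p₃ _ t htp rfl ht₂.symm ht₁.symm w' rfl _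
  have RQ {V : E} (v : V ⟶ (comp p (comp q r)).ext x) (a : V ⟶ r.A)
      (h₂ : (v ≫ assocMap p (comp q r) x ≫ assocMap q r (p.leg x)) ≫ r.out _ = a ≫ r.p₂)
      (a' : V ⟶ q.A)
      (h₂' : r.ev _ (v ≫ assocMap p (comp q r) x ≫ assocMap q r (p.leg x)) a h₂ ≫ q.out _ =
        a' ≫ q.p₂)
      (t : V ⟶ (comp q r).A) (ht₁ : t ≫ a₁ q r = a') (ht₂ : t ≫ a₂ q r = a)
      (htp : (v ≫ (comp p (comp q r)).out x) ≫ (comp q r).out p.p₃ = t ≫ (comp q r).p₂) :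
      q.ev _ (r.ev _ (v ≫ assocMap p (comp q r) x ≫ assocMap q r (p.leg x)) a h₂) a' h₂' =
      (comp q r).ev (p.leg x) (v ≫ assocMap p (comp q r) x) t (by
        rw [← htp, Category.assoc, assocMap_out, Category.assoc]) :=
    ev_ev_assocMap q r (p.leg x) _ t _ (Category.assoc _ _ _).symm ht₂.symm ht₁.symm h₂ rfl _
  apply comp_comp_ext_ext
  · rw [o₁, o₂]
  · intro V v a h₁ h₂
    have w'' := wS v a h₂
    have w := wA v a h₂
    have w' := wM v a w
    rw [eR v a h₂ w'', ← eQ v a w' w'', ← eM v a w w', eA v a h₁ w,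
      Category.assoc (r.ev _ _ _ _), assocMap_out, Category.assoc (r.ev _ _ _ _)]
  · intro V v a h₁ h₂ a' h₁' h₂'
    have w'' := wS v a h₂
    have w := wA v a h₂
    have w' := wM v a w
    obtain ⟨t, ht₁, ht₂, htp⟩ := T v a a' w'' (by rw [← eR v a h₂ w'', h₂'])
    rw [LP v a h₁ a' h₁' w w' t ht₁ ht₂ htp, RQ v a h₂ a' h₂' t ht₁ ht₂ htp,
      ev_assocMap_out p (comp q r) x v t rfl]
  · intro V v a h₁ h₂ a' h₁' h₂' a'' h₁'' h₂''
    have w'' := wS v a h₂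
    have w := wA v a h₂
    have w' := wM v a w
    obtain ⟨t, ht₁, ht₂, htp⟩ := T v a a' w'' (by rw [← eR v a h₂ w'', h₂'])
    have hR := RQ v a h₂ a' h₂' t ht₁ ht₂ htp
    have z : (v ≫ (comp p (comp q r)).out x) ≫ (comp q r).out p.p₃ = t ≫ (comp q r).p₂ := htp
    have z' : (comp q r).ev p.p₃ (v ≫ (comp p (comp q r)).out x) t z = a'' ≫ p.p₂ := by
      rw [← h₁'', LP v a h₁ a' h₁' w w' t ht₁ ht₂ htp]
    let U := pair p (comp q r) _ t z a'' z'
    have hU : v ≫ (comp p (comp q r)).out x = U ≫ (comp p (comp q r)).p₂ := (pair_p₂ ..).symm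
    have hU₁ : a'' = U ≫ a₁ p (comp q r) := (pair_a₁ ..).symm
    have hU₂ : t = U ≫ a₂ p (comp q r) := (pair_a₂ ..).symm
    have hU' : (v ≫ app (associator p q r).inv x) ≫ (comp (comp p q) r).out x =
        (U ≫ assocF₀ p q r) ≫ (comp (comp p q) r).p₂ := by
      rw [Category.assoc, app_out, f₁, Category.assoc, assocF₀_p₂, ← Category.assoc, hU,
        Category.assoc]
    have ha : a = (U ≫ assocF₀ p q r) ≫ a₂ (comp p q) r := by
      rw [Category.assoc, assocF₀_a₂, ← ht₂, hU₂, Category.assoc]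
    have ha' : a' = ((U ≫ assocF₀ p q r) ≫ a₁ (comp p q) r) ≫ a₂ p q := by
      rw [Category.assoc, Category.assoc, assocF₀_a₁_a₂, ← ht₁, hU₂, Category.assoc]
    have ha'' : a'' = ((U ≫ assocF₀ p q r) ≫ a₁ (comp p q) r) ≫ a₁ p q := by
      rw [Category.assoc, Category.assoc, assocF₀_a₁_a₁, hU₁]
    have k : r.ev _ ((v ≫ app (associator p q r).inv x) ≫ assocMap (comp p q) r x) a w ≫
        (comp p q).out x = ((U ≫ assocF₀ p q r) ≫ a₁ (comp p q) r) ≫ (comp p q).p₂ := by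
      rw [ev_assocMap_out (comp p q) r x _ a rfl w,
        a₁_comp_p₂ (comp p q) r (U ≫ assocF₀ p q r) hU' ha, Category.assoc (U ≫ assocF₀ p q r)]
    rw [ev_ev_assocMap p q x _ _ k (eA v a h₁ w) ha' ha'' h₁' rfl,
      ev_ev_assocMap (comp p q) r x _ _ hU' rfl ha rfl w rfl,
      ev_app (associator p q r).inv x v U hU rfl (a' := U ≫ assocF₀ p q r) (by rw [f₀]),
      ev_congr p x hR rfl, ev_ev_assocMap p (comp q r) x v U hU rfl hU₂ hU₁ _ rfl]

end Laws

end Poly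

namespace Poly

section BicategoryLaws

variable {V W X Y Z : E}

theorem comp_comp_hom_ext {s : Poly W Z} {p : Poly W X} {q : Poly X Y} {r : Poly Y Z}
    {f g : s ⟶ comp (comp p q) r} (h : f.f₁ = g.f₁)
    (h₁ : f.f₀ ≫ a₁ (comp p q) r ≫ a₁ p q = g.f₀ ≫ a₁ (comp p q) r ≫ a₁ p q)
    (h₂ : f.f₀ ≫ a₁ (comp p q) r ≫ a₂ p q = g.f₀ ≫ a₁ (comp p q) r ≫ a₂ p q)
    (h₃ : f.f₀ ≫ a₂ (comp p q) r = g.f₀ ≫ a₂ (comp p q) r) : f = g :=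
  hom_ext (top_ext_left (f.w₂.trans ((congrArg (s.p₂ ≫ ·) h).trans g.w₂.symm)) h₁ h₂ h₃) h

theorem comp_comp_comp_hom_ext {s : Poly V Z} {o : Poly V W} {p : Poly W X} {q : Poly X Y}
    {r : Poly Y Z} {f g : s ⟶ comp (comp (comp o p) q) r} (h : f.f₁ = g.f₁)
    (h₁ : f.f₀ ≫ a₁ (comp (comp o p) q) r ≫ a₁ (comp o p) q ≫ a₁ o p =
      g.f₀ ≫ a₁ (comp (comp o p) q) r ≫ a₁ (comp o p) q ≫ a₁ o p)
    (h₂ : f.f₀ ≫ a₁ (comp (comp o p) q) r ≫ a₁ (comp o p) q ≫ a₂ o p =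
      g.f₀ ≫ a₁ (comp (comp o p) q) r ≫ a₁ (comp o p) q ≫ a₂ o p)
    (h₃ : f.f₀ ≫ a₁ (comp (comp o p) q) r ≫ a₂ (comp o p) q =
      g.f₀ ≫ a₁ (comp (comp o p) q) r ≫ a₂ (comp o p) q)
    (h₄ : f.f₀ ≫ a₂ (comp (comp o p) q) r = g.f₀ ≫ a₂ (comp (comp o p) q) r) : f = g := by
  have e : f.f₀ ≫ (comp (comp (comp o p) q) r).p₂ = g.f₀ ≫ (comp (comp (comp o p) q) r).p₂ :=
    f.w₂.trans ((congrArg (s.p₂ ≫ ·) h).trans g.w₂.symm)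
  refine hom_ext (top_ext e (top_ext_left ?_ (by simpa using h₁) (by simpa using h₂)
    (by simpa using h₃)) h₄) h
  have w (t : s.A ⟶ (comp (comp (comp o p) q) r).A) :
      (t ≫ (comp (comp (comp o p) q) r).p₂) ≫ r.out (comp (comp o p) q).p₃ =
        (t ≫ a₂ (comp (comp o p) q) r) ≫ r.p₂ := by
    rw [Category.assoc, Category.assoc, a₂_p₂]
  rw [Category.assoc, Category.assoc, ← a₁_comp_p₂ (comp (comp o p) q) r f.f₀ rfl rfl (w _),
    ← a₁_comp_p₂ (comp (comp o p) q) r g.f₀ rfl rfl (w _)]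
  exact ev_congr _ _ e h₄ _

theorem associator_inv_f₁ (p : Poly W X) (q : Poly X Y) (r : Poly Y Z) :
    (associator p q r).inv.f₁ = assocMap q r p.p₃ := rfl

theorem associator_inv_f₀ (p : Poly W X) (q : Poly X Y) (r : Poly Y Z) :
    (associator p q r).inv.f₀ = assocF₀ p q r := rfl

theorem whiskerLeft_a₁_assoc (p : Poly X Y) {q q' : Poly Y Z} (g : q ⟶ q') {T : E}
    (k : p.A ⟶ T) : (whiskerLeft p g).f₀ ≫ a₁ p q' ≫ k = a₁ p q ≫ k := by
  rw [← Category.assoc, whiskerLeft_a₁]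

theorem whiskerLeft_a₂_assoc (p : Poly X Y) {q q' : Poly Y Z} (g : q ⟶ q') {T : E}
    (k : q'.A ⟶ T) : (whiskerLeft p g).f₀ ≫ a₂ p q' ≫ k = a₂ p q ≫ g.f₀ ≫ k := by
  rw [← Category.assoc, whiskerLeft_a₂, Category.assoc]

theorem whiskerRight_a₁_assoc {p p' : Poly X Y} (f : p ⟶ p') (q : Poly Y Z) {T : E}
    (k : p'.A ⟶ T) : (whiskerRight f q).f₀ ≫ a₁ p' q ≫ k = a₁ p q ≫ f.f₀ ≫ k := by
  rw [← Category.assoc, whiskerRight_a₁, Category.assoc]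

theorem whiskerRight_a₂_assoc {p p' : Poly X Y} (f : p ⟶ p') (q : Poly Y Z) {T : E}
    (k : q.A ⟶ T) : (whiskerRight f q).f₀ ≫ a₂ p' q ≫ k = a₂ p q ≫ k := by
  rw [← Category.assoc, whiskerRight_a₂]

theorem assocF₀_a₁_a₁_assoc (p : Poly W X) (q : Poly X Y) (r : Poly Y Z) {T : E} (k : p.A ⟶ T) :
    assocF₀ p q r ≫ a₁ (comp p q) r ≫ a₁ p q ≫ k = a₁ p (comp q r) ≫ k := by
  rw [← Category.assoc (a₁ (comp p q) r), ← Category.assoc, assocF₀_a₁_a₁]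

theorem assocF₀_a₁_a₂_assoc (p : Poly W X) (q : Poly X Y) (r : Poly Y Z) {T : E} (k : q.A ⟶ T) :
    assocF₀ p q r ≫ a₁ (comp p q) r ≫ a₂ p q ≫ k = a₂ p (comp q r) ≫ a₁ q r ≫ k := by
  rw [← Category.assoc (a₁ (comp p q) r), ← Category.assoc, assocF₀_a₁_a₂, Category.assoc]

theorem assocF₀_a₂_assoc (p : Poly W X) (q : Poly X Y) (r : Poly Y Z) {T : E} (k : r.A ⟶ T) :
    assocF₀ p q r ≫ a₂ (comp p q) r ≫ k = a₂ p (comp q r) ≫ a₂ q r ≫ k := by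
  rw [← Category.assoc, assocF₀_a₂, Category.assoc]

attribute [local simp] whiskerLeft_a₁ whiskerLeft_a₁_assoc whiskerLeft_a₂ whiskerLeft_a₂_assoc
  whiskerRight_a₁ whiskerRight_a₁_assoc whiskerRight_a₂ whiskerRight_a₂_assoc
  assocF₀_a₁_a₁ assocF₀_a₁_a₂ assocF₀_a₂ assocF₀_a₁_a₁_assoc assocF₀_a₁_a₂_assoc assocF₀_a₂_assoc
  associator_inv_f₀

theorem whiskerLeft_id (p : Poly X Y) (q : Poly Y Z) : whiskerLeft p (𝟙 q) = 𝟙 (comp p q) :=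
  comp_hom_ext (app_id p.p₃) (by simp) (by simp)

theorem whiskerLeft_comp (p : Poly X Y) {q q' q'' : Poly Y Z} (f : q ⟶ q') (g : q' ⟶ q'') :
    whiskerLeft p (f ≫ g) = whiskerLeft p f ≫ whiskerLeft p g :=
  comp_hom_ext (app_comp f g p.p₃) (by simp) (by simp)

theorem id_whiskerRight (p : Poly X Y) (q : Poly Y Z) : whiskerRight (𝟙 p) q = 𝟙 (comp p q) :=
  comp_hom_ext ((whiskerRight_f₁ _ _).trans (map_id _ _ _)) (by simp) (by simp)

theorem comp_whiskerRight {p p' p'' : Poly X Y} (f : p ⟶ p') (g : p' ⟶ p'') (q : Poly Y Z) :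
    whiskerRight (f ≫ g) q = whiskerRight f q ≫ whiskerRight g q :=
  comp_hom_ext (by rw [comp_f₁, whiskerRight_f₁, whiskerRight_f₁, whiskerRight_f₁, map_comp]; rfl)
    (by simp) (by simp)

theorem whisker_exchange {p p' : Poly X Y} {q q' : Poly Y Z} (f : p ⟶ p') (g : q ⟶ q') :
    whiskerLeft p g ≫ whiskerRight f q' = whiskerRight f q ≫ whiskerLeft p' g :=
  comp_hom_ext (by
    rw [comp_f₁, comp_f₁, whiskerRight_f₁, whiskerRight_f₁, whiskerLeft_f₁, whiskerLeft_f₁, map_app])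
    (by simp) (by simp)

theorem id_whiskerLeft {p q : Poly X Y} (f : p ⟶ q) :
    whiskerLeft (idPoly X) f ≫ (leftUnitor q).hom = (leftUnitor p).hom ≫ f :=
  hom_ext (by simp [leftUnitor_f₀]) (app_out f (𝟙 X))

theorem whiskerRight_id {p q : Poly X Y} (f : p ⟶ q) :
    whiskerRight f (idPoly Y) ≫ (rightUnitor q).hom = (rightUnitor p).hom ≫ f :=
  hom_ext (by simp [rightUnitor_f₀]) (by
    rw [comp_f₁, comp_f₁, whiskerRight_f₁, rightUnitor_f₁, rightUnitor_f₁, unitMap_natural])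

theorem comp_whiskerLeft (p : Poly W X) (q : Poly X Y) {r r' : Poly Y Z} (f : r ⟶ r') :
    (associator p q r).inv ≫ whiskerLeft (comp p q) f =
      whiskerLeft p (whiskerLeft q f) ≫ (associator p q r').inv :=
  comp_comp_hom_ext (app_whiskerLeft q f p.p₃).symm (by simp) (by simp) (by simp)

theorem whiskerRight_comp {p p' : Poly W X} (f : p ⟶ p') (q : Poly X Y) (r : Poly Y Z) :
    whiskerRight f (comp q r) ≫ (associator p' q r).inv =
      (associator p q r).inv ≫ whiskerRight (whiskerRight f q) r :=
  comp_comp_hom_ext (by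
    simp only [comp_f₁, whiskerRight_f₁, associator_inv_f₁]
    exact assocMap_natural q r f.f₁ f.w₃) (by simp) (by simp) (by simp)

theorem whisker_assoc (p : Poly W X) {q q' : Poly X Y} (f : q ⟶ q') (r : Poly Y Z) :
    (associator p q r).inv ≫ whiskerRight (whiskerLeft p f) r =
      whiskerLeft p (whiskerRight f r) ≫ (associator p q' r).inv :=
  comp_comp_hom_ext (by
    simp only [comp_f₁, whiskerRight_f₁, associator_inv_f₁]
    exact (app_whiskerRight f r p.p₃).symm) (by simp) (by simp) (by simp)

theorem pentagon_inv (o : Poly V W) (p : Poly W X) (q : Poly X Y) (r : Poly Y Z) :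
    whiskerLeft o (associator p q r).inv ≫ (associator o (comp p q) r).inv ≫
      whiskerRight (associator o p q).inv r =
    (associator o p (comp q r)).inv ≫ (associator (comp o p) q r).inv :=
  comp_comp_comp_hom_ext (by
    simp only [comp_f₁, whiskerRight_f₁, associator_inv_f₁]
    exact app_associator_inv p q r o.p₃) (by simp) (by simp) (by simp) (by simp)

theorem triangle_inv (p : Poly X Y) (q : Poly Y Z) :
    (associator p (idPoly Y) q).inv ≫ whiskerRight (rightUnitor p).hom q =
      whiskerLeft p (leftUnitor q).hom :=
  comp_hom_ext (by
    simp only [comp_f₁, whiskerRight_f₁, associator_inv_f₁]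
    exact (app_leftUnitor q p.p₃).symm)
    (by simp [rightUnitor_f₀]) (by simp [leftUnitor_f₀])

/-- Whiskering of an isomorphism. -/
def whiskerLeftIso (p : Poly X Y) {q q' : Poly Y Z} (e : q ≅ q') : comp p q ≅ comp p q' :=
  ⟨whiskerLeft p e.hom, whiskerLeft p e.inv,
    by rw [← whiskerLeft_comp, e.hom_inv_id, whiskerLeft_id],
    by rw [← whiskerLeft_comp, e.inv_hom_id, whiskerLeft_id]⟩

/-- Whiskering of an isomorphism. -/
def whiskerRightIso {p p' : Poly X Y} (e : p ≅ p') (q : Poly Y Z) : comp p q ≅ comp p' q :=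
  ⟨whiskerRight e.hom q, whiskerRight e.inv q,
    by rw [← comp_whiskerRight, e.hom_inv_id, id_whiskerRight],
    by rw [← comp_whiskerRight, e.inv_hom_id, id_whiskerRight]⟩

theorem pentagon (o : Poly V W) (p : Poly W X) (q : Poly X Y) (r : Poly Y Z) :
    whiskerRight (associator o p q).hom r ≫ (associator o (comp p q) r).hom ≫
      whiskerLeft o (associator p q r).hom =
    (associator (comp o p) q r).hom ≫ (associator o p (comp q r)).hom := by
  have : whiskerRightIso (associator o p q) r ≪≫ associator o (comp p q) r ≪≫
      whiskerLeftIso o (associator p q r) =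
    associator (comp o p) q r ≪≫ associator o p (comp q r) := by
    apply Iso.ext_inv
    have := pentagon_inv o p q r
    simpa [whiskerRightIso, whiskerLeftIso] using this
  exact congrArg Iso.hom this

end BicategoryLaws

end Poly

/-- The objects of the bicategory of polynomials in `E`: the objects of `E`. -/
@[ext]
structure PolyObj (E : Type u) where
  obj : E

/-- The bicategory of polynomials: objects are those of `E`, 1-cells are polynomials, 2-cells are
cartesian morphisms. The composite `p ≫ q` is "first `p`, then `q`". -/
instance : Bicategory.{v, max u v} (PolyObj E) where
  Hom X Y := Poly X.obj Y.obj
  id X := Poly.idPoly X.obj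
  comp p q := Poly.comp p q
  homCategory X Y := inferInstanceAs (Category (Poly X.obj Y.obj))
  whiskerLeft p _ _ g := Poly.whiskerLeft p g
  whiskerRight f q := Poly.whiskerRight f q
  associator p q r := Poly.associator p q r
  leftUnitor p := Poly.leftUnitor p
  rightUnitor p := Poly.rightUnitor p
  whiskerLeft_id p q := Poly.whiskerLeft_id p q
  whiskerLeft_comp p _ _ _ f g := Poly.whiskerLeft_comp p f g
  id_whiskerRight p q := Poly.id_whiskerRight p q
  comp_whiskerRight f g q := Poly.comp_whiskerRight f g q
  whisker_exchange f g := Poly.whisker_exchange f g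
  id_whiskerLeft f := by
    have := Poly.id_whiskerLeft f
    exact (Iso.eq_comp_inv _).2 this |>.trans (Category.assoc _ _ _)
  whiskerRight_id f := by
    have := Poly.whiskerRight_id f
    exact (Iso.eq_comp_inv _).2 this |>.trans (Category.assoc _ _ _)
  comp_whiskerLeft p q _ _ f := (Iso.inv_comp_eq _).1 (Poly.comp_whiskerLeft p q f)
  whiskerRight_comp f q r := by
    have := Poly.whiskerRight_comp f q r
    exact (Iso.eq_comp_inv (Poly.associator _ q r).symm).2 this |>.trans (Category.assoc _ _ _)
  whisker_assoc p _ _ f r := (Iso.inv_comp_eq _).1 (Poly.whisker_assoc p f r)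
  pentagon o p q r := Poly.pentagon o p q r
  triangle p q := ((Iso.inv_comp_eq _).1 (Poly.triangle_inv p q)).symm

section CatPb

open Bicategory

/-- A category with pullbacks. -/
structure CatPb where
  carrier : Type u
  [category : Category.{v} carrier]
  [hasPullbacks : HasPullbacks carrier]

attribute [instance] CatPb.category CatPb.hasPullbacks

/-- A pullback preserving functor. -/
structure PbFunctor (C D : CatPb.{v, u}) where
  functor : C.carrier ⥤ D.carrier
  preserves : PreservesLimitsOfShape WalkingCospan functor

attribute [instance] PbFunctor.preserves

/-- A cartesian transformation: a natural transformation whose naturality squares are pullbacks. -/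
@[ext]
structure CartTrans {C D : CatPb.{v, u}} (F G : PbFunctor C D) where
  nat : F.functor ⟶ G.functor
  cartesian : NatTrans.Equifibered nat

instance (C D : CatPb.{v, u}) : Category (PbFunctor C D) where
  Hom F G := CartTrans F G
  id F := ⟨𝟙 F.functor, NatTrans.Equifibered.of_isIso _⟩
  comp f g := ⟨f.nat ≫ g.nat, f.cartesian.comp g.cartesian⟩
  id_comp _ := CartTrans.ext (Category.id_comp _)
  comp_id _ := CartTrans.ext (Category.comp_id _)
  assoc _ _ _ := CartTrans.ext (Category.assoc _ _ _)

namespace PbFunctor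

variable {C D : CatPb.{v, u}}

theorem hom_ext {F G : PbFunctor C D} {f g : F ⟶ G} (h : ∀ X, f.nat.app X = g.nat.app X) : f = g :=
  CartTrans.ext (NatTrans.ext (funext h))

@[simp] theorem id_nat (F : PbFunctor C D) : CartTrans.nat (𝟙 F) = 𝟙 F.functor := rfl
@[simp] theorem comp_nat {F G H : PbFunctor C D} (f : F ⟶ G) (g : G ⟶ H) :
    (f ≫ g).nat = f.nat ≫ g.nat := rfl

/-- An isomorphism of pullback preserving functors from a natural isomorphism. -/
def isoMk {F G : PbFunctor C D} (e : F.functor ≅ G.functor) : F ≅ G where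
  hom := ⟨e.hom, NatTrans.Equifibered.of_isIso _⟩
  inv := ⟨e.inv, NatTrans.Equifibered.of_isIso _⟩
  hom_inv_id := CartTrans.ext e.hom_inv_id
  inv_hom_id := CartTrans.ext e.inv_hom_id

@[simp] theorem isoMk_hom_nat {F G : PbFunctor C D} (e : F.functor ≅ G.functor) :
    (isoMk e).hom.nat = e.hom := rfl
@[simp] theorem isoMk_inv_nat {F G : PbFunctor C D} (e : F.functor ≅ G.functor) :
    (isoMk e).inv.nat = e.inv := rfl

end PbFunctor

/-- The bicategory of categories with pullbacks, pullback preserving functors and cartesian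
transformations. -/
instance : Bicategory.{max u v, max u v} CatPb.{v, u} where
  Hom C D := PbFunctor C D
  id C := ⟨𝟭 C.carrier, inferInstance⟩
  comp F G := ⟨F.functor ⋙ G.functor, inferInstance⟩
  homCategory C D := inferInstanceAs (Category (PbFunctor C D))
  whiskerLeft F _ _ g := ⟨Functor.whiskerLeft F.functor g.nat, g.cartesian.whiskerLeft F.functor⟩
  whiskerRight f G := ⟨Functor.whiskerRight f.nat G.functor, f.cartesian.whiskerRight G.functor⟩
  associator F G H := PbFunctor.isoMk (Functor.associator F.functor G.functor H.functor)
  leftUnitor F := PbFunctor.isoMk F.functor.leftUnitor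
  rightUnitor F := PbFunctor.isoMk F.functor.rightUnitor
  whiskerLeft_id F G := PbFunctor.hom_ext fun X => by simp
  whiskerLeft_comp F _ _ _ f g := PbFunctor.hom_ext fun X => by simp
  id_whiskerLeft f := PbFunctor.hom_ext fun X => by simp
  comp_whiskerLeft F G _ _ f := PbFunctor.hom_ext fun X => by simp
  id_whiskerRight F G := PbFunctor.hom_ext fun X => by simp
  comp_whiskerRight f g G := PbFunctor.hom_ext fun X => by simp
  whiskerRight_id f := PbFunctor.hom_ext fun X => by simp
  whiskerRight_comp f G H := PbFunctor.hom_ext fun X => by simp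
  whisker_assoc F _ _ f H := PbFunctor.hom_ext fun X => by simp
  whisker_exchange f g := PbFunctor.hom_ext fun X => by simp
  pentagon F G H K := PbFunctor.hom_ext fun X => by simp
  triangle F G := PbFunctor.hom_ext fun X => by simp

end CatPb

namespace Poly

section Cartesian

variable {X Y : E} {p q : Poly X Y} (f : p ⟶ q)

theorem isPullback_app_out {C : E} (x : C ⟶ X) :
    IsPullback (app f x) (p.out x) (q.out x) f.f₁ := by
  have key (s : PullbackCone (q.out x) f.f₁) : ∃ m : s.pt ⟶ p.ext x,
      m ≫ app f x = s.fst ∧ m ≫ p.out x = s.snd := by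
    have hV := IsPullback.of_hasPullback s.snd p.p₂
    have w : (pullback.fst s.snd p.p₂ ≫ s.fst) ≫ q.out x =
        (pullback.snd s.snd p.p₂ ≫ f.f₀) ≫ q.p₂ := by
      rw [Category.assoc, s.condition, pullback.condition_assoc, Category.assoc, f.w₂]
    have o : p.lift x s.snd _ _ hV (q.ev x _ _ w) (by rw [ev_w, Category.assoc, f.w₁']) ≫
        p.out x = s.snd := lift_out ..
    refine ⟨_, ?_, o⟩
    refine q.ext_ext (b := s.snd ≫ f.f₁) ?_ (hV.flip.paste_horiz f.isPullback.flip.flip).flip ?_ ?_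
    · rw [Category.assoc, app_out, ← Category.assoc, o, s.condition]
    · rw [Category.assoc, app_out, ← Category.assoc, o]
    · rw [ev_app f x (pullback.fst s.snd p.p₂ ≫ p.lift x s.snd _ _ hV (q.ev x _ _ w)
        (by rw [ev_w, Category.assoc, f.w₁'])) (pullback.snd s.snd p.p₂)
        (by rw [Category.assoc, o, pullback.condition]) (Category.assoc _ _ _).symm rfl]
      exact (ev_lift p x s.snd _ _ hV (q.ev x _ _ w) (by rw [ev_w, Category.assoc, f.w₁'])
        (𝟙 _) (Category.id_comp _).symm (Category.id_comp _).symm _).trans (Category.id_comp _)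
  refine ⟨⟨app_out f x⟩, ⟨PullbackCone.IsLimit.mk _ (fun s => (key s).choose)
    (fun s => (key s).choose_spec.1) (fun s => (key s).choose_spec.2) ?_⟩⟩
  intro s m h₁ h₂
  have h₃ := h₂.trans (key s).choose_spec.2.symm
  refine p.ext_ext' h₃ fun V v a z z' => ?_
  rw [← ev_app f x (v ≫ m) a z (n' := v ≫ s.fst) (by rw [Category.assoc, h₁]) rfl
      (by rw [← h₁, ← Category.assoc v m, Category.assoc (v ≫ m), app_out, ← Category.assoc, z,
        Category.assoc, Category.assoc, f.w₂]),
    ← ev_app f x (v ≫ (key s).choose) a z' (n' := v ≫ s.fst)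
      (by rw [Category.assoc, (key s).choose_spec.1]) rfl
      (by rw [← h₁, ← Category.assoc v m, Category.assoc (v ≫ m), app_out, ← Category.assoc, z,
        Category.assoc, Category.assoc, f.w₂])]

theorem isPullback_map_app {C C' : E} {x : C ⟶ X} {x' : C' ⟶ X} (t : C ⟶ C') (ht : t ≫ x' = x) :
    IsPullback (p.map t ht) (app f x) (app f x') (q.map t ht) := by
  refine IsPullback.flip (IsPullback.of_bot (h₃₁ := f.f₁) (v₂₁ := p.out x') (v₂₂ := q.out x')
    ?_ (map_app f t ht).symm (isPullback_app_out f x'))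
  rw [map_out, map_out]
  exact isPullback_app_out f x

/-- The cartesian transformation induced by a cartesian morphism of polynomials. -/
def appNat : p.functor ⟶ q.functor where
  app x := Over.homMk (app f x.hom) (app_leg f x.hom)
  naturality x x' t := by
    ext
    exact map_app f t.left (Over.w t)

theorem appNat_cartesian : NatTrans.Equifibered (appNat f) := by
  intro x x' t
  refine IsPullback.of_map (Over.forget Y) ((appNat f).naturality t) ?_
  exact isPullback_map_app f t.left (Over.w t)

instance (p : Poly X Y) : PreservesLimitsOfShape WalkingCospan p.functor := by
  have h₁ : PreservesLimitsOfShape WalkingCospan (Over.pullback p.p₁) :=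
    (Over.mapPullbackAdj p.p₁).rightAdjoint_preservesLimits.preservesLimitsOfShape
  have h₂ : PreservesLimitsOfShape WalkingCospan (piFunctor p.p₂ p.exp) :=
    (piAdj p.p₂ p.exp).rightAdjoint_preservesLimits.preservesLimitsOfShape
  have h₃ : PreservesLimitsOfShape WalkingCospan (Over.map p.p₃) := by
    have : PreservesLimitsOfShape WalkingCospan (Over.map p.p₃ ⋙ Over.forget Y) :=
      inferInstanceAs (PreservesLimitsOfShape WalkingCospan (Over.forget p.B))
    exact preservesLimitsOfShape_of_reflects_of_preserves _ (Over.forget Y)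
  unfold functor
  infer_instance

/-- The isomorphism between the polynomial functor of the identity and the identity. -/
def functorId (X : E) : (idPoly X).functor ≅ 𝟭 (Over X) :=
  NatIso.ofComponents (fun x => Over.isoMk
      ⟨unitMap x.hom, unitInv x.hom, unitMap_inv x.hom, unitInv_map x.hom⟩ (unitMap_leg x.hom))
    (fun t => by
      ext
      exact unitMap_natural t.left (Over.w t))

/-- The isomorphism between the polynomial functor of a composite and the composite of the
polynomial functors. -/
def functorComp {X Y Z : E} (p : Poly X Y) (q : Poly Y Z) :
    (comp p q).functor ≅ p.functor ⋙ q.functor :=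
  NatIso.ofComponents (fun x => Over.isoMk
      ⟨assocMap p q x.hom, assocInv p q x.hom, assocMap_inv p q x.hom, assocInv_map p q x.hom⟩
      (assocMap_leg p q x.hom))
    (fun t => by
      ext
      exact assocMap_natural p q t.left (Over.w t))

section Components

variable {W X Y Z : E}

theorem app_whiskerLeft_eq (p : Poly X Y) {q q' : Poly Y Z} (g : q ⟶ q') {C : E} (x : C ⟶ X) :
    app (whiskerLeft p g) x = assocMap p q x ≫ app g (p.leg x) ≫ assocInv p q' x := by
  rw [← Category.assoc, ← app_whiskerLeft, Category.assoc, assocMap_inv, Category.comp_id]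

theorem app_whiskerRight_eq {p p' : Poly X Y} (f : p ⟶ p') (q : Poly Y Z) {C : E} (x : C ⟶ X) :
    app (whiskerRight f q) x =
      assocMap p q x ≫ q.map (app f x) (app_leg f x) ≫ assocInv p' q x := by
  rw [← Category.assoc, ← app_whiskerRight, Category.assoc, assocMap_inv, Category.comp_id]

theorem app_associator_eq (p : Poly W X) (q : Poly X Y) (r : Poly Y Z) {C : E} (x : C ⟶ W) :
    app (associator p q r).hom x = assocMap (comp p q) r x ≫
      r.map (assocMap p q x) (assocMap_leg p q x) ≫ assocInv q r (p.leg x) ≫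
        assocInv p (comp q r) x := by
  have h : app (associator p q r).hom x ≫ app (associator p q r).inv x = 𝟙 _ := by
    rw [← app_comp, Iso.hom_inv_id, app_id]
  have h' := congrArg (fun k => app (associator p q r).hom x ≫ k ≫ assocInv q r (p.leg x) ≫
    assocInv p (comp q r) x) (app_associator_inv p q r x)
  simp only [Category.assoc] at h'
  rw [← Category.assoc (assocMap q r (p.leg x)), assocMap_inv, Category.id_comp, assocMap_inv,
    Category.comp_id, ← Category.assoc (app (associator p q r).hom x), h, Category.id_comp] at h'
  exact h'.symm

end Components

end Cartesian

end Poly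

open Bicategory

/-- The slice category `E/X`, as a category with pullbacks. -/
abbrev slice (X : E) : CatPb.{v, max u v} := ⟨Over X⟩

/-- The homomorphism of bicategories sending `X` to `E/X` and a polynomial `p` to the polynomial
functor `Σ_{p₃} Π_{p₂} Δ_{p₁}`. -/
def polyFunctor (E : Type u) [Category.{v} E] [HasPullbacks E] :
    Pseudofunctor (PolyObj E) CatPb.{v, max u v} where
  obj X := slice X.obj
  map p := ⟨Poly.functor p, inferInstance⟩
  map₂ f := ⟨Poly.appNat f, Poly.appNat_cartesian f⟩
  map₂_id p := PbFunctor.hom_ext fun x => by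
    ext
    exact Poly.app_id x.hom
  map₂_comp f g := PbFunctor.hom_ext fun x => by
    ext
    exact Poly.app_comp f g x.hom
  mapId X := PbFunctor.isoMk (Poly.functorId X.obj)
  mapComp p q := PbFunctor.isoMk (Poly.functorComp p q)
  map₂_whisker_left p _ _ g := PbFunctor.hom_ext fun x => by
    ext
    exact Poly.app_whiskerLeft_eq p g x.hom
  map₂_whisker_right f q := PbFunctor.hom_ext fun x => by
    ext
    exact Poly.app_whiskerRight_eq f q x.hom
  map₂_associator p q r := PbFunctor.hom_ext fun x => by
    ext
    exact (Poly.app_associator_eq p q r x.hom).trans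
      (congrArg (fun k => _ ≫ _ ≫ k) (Category.id_comp _).symm)
  map₂_left_unitor p := PbFunctor.hom_ext fun x => by
    ext
    exact (Poly.app_leftUnitor p x.hom).trans
      (congrArg _ (Category.comp_id _).symm)
  map₂_right_unitor p := PbFunctor.hom_ext fun x => by
    ext
    exact (Poly.app_rightUnitor p x.hom).trans
      (congrArg _ (Category.comp_id _).symm)

section CatPbBicategory

universe w₁ v₁ u₁ w₂ v₂ u₂

variable (B : Type u₁) [Bicategory.{w₁, v₁} B]

/-- The composition functors of a bicategory. -/
@[simps]
def compFunctor {B : Type u₁} [Bicategory.{w₁, v₁} B] (a b c : B) :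
    (a ⟶ b) × (b ⟶ c) ⥤ (a ⟶ c) where
  obj f := f.1 ≫ f.2
  map {f g} η := η.1 ▷ f.2 ≫ g.1 ◁ η.2
  map_id f := by simp
  map_comp {f g h} η θ := by
    simp only [prod_comp, comp_whiskerRight, whiskerLeft_comp, Category.assoc,
      whisker_exchange_assoc]

/-- A bicategory enriched in categories with pullbacks: its hom categories have pullbacks, and
its composition functors preserve them. -/
structure IsCatPbBicategory : Prop where
  hasPullbacks (a b : B) : HasPullbacks (a ⟶ b)
  preserves (a b c : B) : PreservesLimitsOfShape WalkingCospan (compFunctor a b c)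

variable {B} {C : Type u₂} [Bicategory.{w₂, v₂} C]

/-- A homomorphism of bicategories enriched in categories with pullbacks: a homomorphism of
bicategories whose hom functors preserve pullbacks. -/
structure IsCatPbHom (F : Pseudofunctor B C) : Prop where
  preserves (a b : B) :
    PreservesLimitsOfShape WalkingCospan (F.toPrelaxFunctor.mapFunctor a b)

end CatPbBicategory

end

end PolyPb

/-! A cartesian 2-cell with target `r` presents its source as a fibre product, over an object that
depends on `r` alone, of `r`-data with something simpler. If `f : p ⟶ r` is a cartesian morphism of
polynomials, then `p.A` is the fibre product of `p.B` and `r.A` over `r.B`, and by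
`isPullback_app_out` the value p(x) is the fibre product of `p.B` and r(x) over `r.B`. If `f : p ⟶
r` is a cartesian transformation and c ⟶ d is an arrow, then p(c) is the fibre product of r(c) and
p(d) over r(d). In a commutative square of such 2-cells ending at `r`, the objects to be compared
are therefore fibre products over one fixed object, and fibre products commute with pullbacks. This
is `isPullback_fiberProduct`; every preservation statement below comes down to it.

For polynomials, a square of cartesian morphisms is a pullback exactly when its square of bases is
one (`Poly.isPullback_of_f₁`, `Poly.isPullback_f₁`). A pullback is built by taking pullbacks of the
`A`s and of the `B`s. The cube lemma `isPullback_side` shows that its projections are cartesian, so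
its middle map is a base change of an exponentiable map and hence exponentiable. The base of the
composite of p and p' is p'(`p.p₃`), which for a 2-cell from p' to r' is the fibre product of
r'(`p.p₃`) and `p'.B` over `r'.B`. The first factor carries a pullback of the p's to a pullback
because polynomial functors preserve pullbacks. The second does so because the p' have a pullback of
bases.

In the bicategory of categories with pullbacks, pullbacks of 2-cells are pointwise. The pointwise
pullback of functors preserves pullbacks because it maps by a cartesian transformation to a functor
that does. Composition is handled by writing p'(p X) as the fibre product of r'(p X) and p'(r X)
over r'(r X).

Finally, the homomorphism to categories with pullbacks preserves pullbacks of 2-cells because these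
are pointwise in the target, and evaluation at x turns a pullback of bases into a pullback in `E`.
-/

namespace PolyPb

/-! ### Pullback squares in an arbitrary category. -/

section General

universe v₁ u₁ v₂ u₂

variable {C : Type u₁} [Category.{v₁} C] {D : Type u₂} [Category.{v₂} D]

/-- A functor sending pullback squares to pullback squares preserves pullbacks. -/
theorem preservesPullbacks_of_map [HasPullbacks C] (F : C ⥤ D)
    (h : ∀ {P X Y Z : C} {k : P ⟶ X} {l : P ⟶ Y} {f : X ⟶ Z} {g : Y ⟶ Z},
      IsPullback k l f g → IsPullback (F.map k) (F.map l) (F.map f) (F.map g)) :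
    PreservesLimitsOfShape WalkingCospan F :=
  preservesLimitsOfShape_walkingCospan_of_forall_isPullback fun _ _ _ f g _ =>
    ⟨_, _, _, IsPullback.of_hasPullback f g, h (IsPullback.of_hasPullback f g)⟩

theorem hasPullbacks_of_exists
    (h : ∀ {X Y Z : C} (f : X ⟶ Z) (g : Y ⟶ Z), ∃ (P : C) (k : P ⟶ X) (l : P ⟶ Y),
      IsPullback k l f g) : HasPullbacks C := by
  have : ∀ {X Y Z : C} {f : X ⟶ Z} {g : Y ⟶ Z}, HasLimit (cospan f g) := by
    intro X Y Z f g
    obtain ⟨P, k, l, hP⟩ := h f g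
    exact hP.hasPullback
  exact hasPullbacks_of_hasLimit_cospan C

/-- Composition functors are defined on a product of hom categories, where limits are computed in
each factor. -/
theorem isPullback_prod {P X Y Z : C × D} {k : P ⟶ X} {l : P ⟶ Y} {f : X ⟶ Z} {g : Y ⟶ Z}
    (h₁ : IsPullback k.1 l.1 f.1 g.1) (h₂ : IsPullback k.2 l.2 f.2 g.2) : IsPullback k l f g :=
  IsPullback.mk' (Prod.ext h₁.w h₂.w)
    (fun _ _ _ e e' => Prod.ext
      (h₁.hom_ext (congrArg Prod.fst e) (congrArg Prod.fst e'))
      (h₂.hom_ext (congrArg Prod.snd e) (congrArg Prod.snd e')))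
    (fun _ a b e => ⟨(h₁.lift a.1 b.1 (congrArg Prod.fst e), h₂.lift a.2 b.2 (congrArg Prod.snd e)),
      Prod.ext (h₁.lift_fst _ _ _) (h₂.lift_fst _ _ _),
      Prod.ext (h₁.lift_snd _ _ _) (h₂.lift_snd _ _ _)⟩)

/-- To preserve pullbacks, a functor of two variables may be tested on pairs of pullback squares. -/
theorem preservesPullbacks_of_prod_map {D' : Type*} [Category* D'] [HasPullbacks C]
    [HasPullbacks D] (F : C × D ⥤ D')
    (h : ∀ {P X Y Z : C × D} {k : P ⟶ X} {l : P ⟶ Y} {f : X ⟶ Z} {g : Y ⟶ Z},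
      IsPullback k.1 l.1 f.1 g.1 → IsPullback k.2 l.2 f.2 g.2 →
        IsPullback (F.map k) (F.map l) (F.map f) (F.map g)) :
    PreservesLimitsOfShape WalkingCospan F :=
  preservesLimitsOfShape_walkingCospan_of_forall_isPullback fun X Y _ f g _ =>
    have h₁ := IsPullback.of_hasPullback f.1 g.1
    have h₂ := IsPullback.of_hasPullback f.2 g.2
    -- One pullback per cospan is enough for preservation. Choosing the componentwise one lets `h`
    -- assume two separate pullback squares, so no pullback in the product category ever has to be
    -- decomposed.
    let P : C × D := (pullback f.1 g.1, pullback f.2 g.2)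
    let k : P ⟶ X := (pullback.fst f.1 g.1, pullback.fst f.2 g.2)
    let l : P ⟶ Y := (pullback.snd f.1 g.1, pullback.snd f.2 g.2)
    ⟨P, k, l, isPullback_prod h₁ h₂, h h₁ h₂⟩

/-- This serves as the second factor in `isPullback_fiberProduct` when only one factor varies. -/
theorem isPullback_const (X : C) : IsPullback (𝟙 X) (𝟙 X) (𝟙 X) (𝟙 X) :=
  IsPullback.of_horiz_isIso ⟨rfl⟩

/-- Fibre products over a fixed object of two pullback squares form a pullback square. -/
theorem isPullback_fiberProduct {X₀ X₁ X₂ X₃ Y₀ Y₁ Y₂ Y₃ W₀ W₁ W₂ W₃ Z : C}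
    {k : W₀ ⟶ W₁} {l : W₀ ⟶ W₂} {f : W₁ ⟶ W₃} {g : W₂ ⟶ W₃} (w : k ≫ f = l ≫ g)
    {kX : X₀ ⟶ X₁} {lX : X₀ ⟶ X₂} {fX : X₁ ⟶ X₃} {gX : X₂ ⟶ X₃} (hX : IsPullback kX lX fX gX)
    {kY : Y₀ ⟶ Y₁} {lY : Y₀ ⟶ Y₂} {fY : Y₁ ⟶ Y₃} {gY : Y₂ ⟶ Y₃} (hY : IsPullback kY lY fY gY)
    {π₀ : W₀ ⟶ X₀} {ρ₀ : W₀ ⟶ Y₀} {a₀ : X₀ ⟶ Z} {b₀ : Y₀ ⟶ Z} (h₀ : IsPullback π₀ ρ₀ a₀ b₀)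
    {π₁ : W₁ ⟶ X₁} {ρ₁ : W₁ ⟶ Y₁} {a₁ : X₁ ⟶ Z} {b₁ : Y₁ ⟶ Z} (h₁ : IsPullback π₁ ρ₁ a₁ b₁)
    {π₂ : W₂ ⟶ X₂} {ρ₂ : W₂ ⟶ Y₂} {a₂ : X₂ ⟶ Z} {b₂ : Y₂ ⟶ Z} (h₂ : IsPullback π₂ ρ₂ a₂ b₂)
    {π₃ : W₃ ⟶ X₃} {ρ₃ : W₃ ⟶ Y₃}
    (ha : kX ≫ a₁ = a₀) (hb : kY ≫ b₁ = b₀)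
    (ek : k ≫ π₁ = π₀ ≫ kX) (ek' : k ≫ ρ₁ = ρ₀ ≫ kY)
    (el : l ≫ π₂ = π₀ ≫ lX) (el' : l ≫ ρ₂ = ρ₀ ≫ lY)
    (ef : f ≫ π₃ = π₁ ≫ fX) (ef' : f ≫ ρ₃ = ρ₁ ≫ fY)
    (eg : g ≫ π₃ = π₂ ≫ gX) (eg' : g ≫ ρ₃ = ρ₂ ≫ gY) : IsPullback k l f g := by
  -- The corner `W₃` need not be a fibre product. It is used only to pass from an equation in `W₃`
  -- to equations in `X₃` and `Y₃`, so arbitrary compatible maps `π₃` and `ρ₃` suffice.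
  refine IsPullback.mk' w ?_ ?_
  · intro T φ φ' e e'
    refine h₀.hom_ext (hX.hom_ext ?_ ?_) (hY.hom_ext ?_ ?_)
    · simp only [Category.assoc, ← ek, reassoc_of% e]
    · simp only [Category.assoc, ← el, reassoc_of% e']
    · simp only [Category.assoc, ← ek', reassoc_of% e]
    · simp only [Category.assoc, ← el', reassoc_of% e']
  · intro T a b e
    have eX : (a ≫ π₁) ≫ fX = (b ≫ π₂) ≫ gX := by
      simp only [Category.assoc, ← ef, ← eg, reassoc_of% e]
    have eY : (a ≫ ρ₁) ≫ fY = (b ≫ ρ₂) ≫ gY := by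
      simp only [Category.assoc, ← ef', ← eg', reassoc_of% e]
    refine ⟨h₀.lift (hX.lift _ _ eX) (hY.lift _ _ eY) ?_, h₁.hom_ext ?_ ?_, h₂.hom_ext ?_ ?_⟩
    -- The two lifts agree over `Z` because both can be tested after passing to corner 1. This is
    -- why compatibility with `Z` is assumed along `k` but not along `l`.
    · rw [← ha, ← hb, hX.lift_fst_assoc, hY.lift_fst_assoc, Category.assoc, h₁.w, Category.assoc]
    · rw [Category.assoc, ek, h₀.lift_fst_assoc, hX.lift_fst]
    · rw [Category.assoc, ek', h₀.lift_snd_assoc, hY.lift_fst]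
    · rw [Category.assoc, el, h₀.lift_fst_assoc, hX.lift_snd]
    · rw [Category.assoc, el', h₀.lift_snd_assoc, hY.lift_snd]

/-- In a cube whose top and bottom are pullbacks, the side opposite to a pullback is a pullback. -/
theorem isPullback_side {A₀ A₁ A₂ A₃ B₀ B₁ B₂ B₃ : C}
    {kA : A₀ ⟶ A₁} {lA : A₀ ⟶ A₂} {fA : A₁ ⟶ A₃} {gA : A₂ ⟶ A₃} (hA : IsPullback kA lA fA gA)
    {kB : B₀ ⟶ B₁} {lB : B₀ ⟶ B₂} {fB : B₁ ⟶ B₃} {gB : B₂ ⟶ B₃} (hB : IsPullback kB lB fB gB)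
    {p₀ : A₀ ⟶ B₀} {p₁ : A₁ ⟶ B₁} {p₂ : A₂ ⟶ B₂} {p₃ : A₃ ⟶ B₃}
    (ek : kA ≫ p₁ = p₀ ≫ kB) (el : lA ≫ p₂ = p₀ ≫ lB) (ef : fA ≫ p₃ = p₁ ≫ fB)
    (hg : IsPullback gA p₂ p₃ gB) : IsPullback kA p₀ p₁ kB := by
  -- By cancellation it is enough that the wanted face followed by the bottom is a pullback. By
  -- commutativity of the cube, that composite is the top followed by the given face `hg`.
  refine IsPullback.of_bot ?_ ek hB
  rw [← el, ← ef]
  exact hA.paste_vert hg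

end General

variable {E : Type u} [Category.{v} E] [HasPullbacks E]

/-! ### Pullbacks of polynomials, detected on bases. -/

namespace Poly

variable {X Y Z : E}

/-- Each of `s.A`, `p.A`, `q.A` is the base change along `r.p₂` of the corresponding base over
`r.B`, and base change preserves pullbacks. In `isPullback_fiberProduct` the fixed object is `r.B`,
the varying factor is the square of bases, and the constant factor is `r.A`. -/
theorem isPullback_f₀ {s p q r : Poly X Y} {k : s ⟶ p} {l : s ⟶ q} {f : p ⟶ r} {g : q ⟶ r}
    (w : k ≫ f = l ≫ g) (h : IsPullback k.f₁ l.f₁ f.f₁ g.f₁) :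
    IsPullback k.f₀ l.f₀ f.f₀ g.f₀ := by
  have w₀ : k.f₀ ≫ f.f₀ = l.f₀ ≫ g.f₀ := congrArg Hom.f₀ w
  exact isPullback_fiberProduct w₀ h (isPullback_const r.A)
    (k.isPullback.paste_horiz f.isPullback).flip f.isPullback.flip g.isPullback.flip
    rfl (Category.id_comp _) k.w₂ (Category.comp_id _).symm l.w₂
    (w₀.symm.trans (Category.comp_id _).symm) f.w₂ rfl g.w₂ rfl

/-- A commutative square of cartesian morphisms is a pullback if its square of bases is. -/
theorem isPullback_of_f₁ {s p q r : Poly X Y} {k : s ⟶ p} {l : s ⟶ q} {f : p ⟶ r} {g : q ⟶ r}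
    (w : k ≫ f = l ≫ g) (h : IsPullback k.f₁ l.f₁ f.f₁ g.f₁) : IsPullback k l f g := by
  have h₀ := isPullback_f₀ w h
  refine IsPullback.mk' w ?_ ?_
  · intro T φ φ' e e'
    exact hom_ext (h₀.hom_ext (congrArg Hom.f₀ e) (congrArg Hom.f₀ e'))
      (h.hom_ext (congrArg Hom.f₁ e) (congrArg Hom.f₁ e'))
  · intro T a b e
    let m₀ := h₀.lift a.f₀ b.f₀ (congrArg Hom.f₀ e)
    let m₁ := h.lift a.f₁ b.f₁ (congrArg Hom.f₁ e)
    have e₀ : m₀ ≫ k.f₀ = a.f₀ := h₀.lift_fst _ _ _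
    have e₀' : m₀ ≫ l.f₀ = b.f₀ := h₀.lift_snd _ _ _
    have e₁ : m₁ ≫ k.f₁ = a.f₁ := h.lift_fst _ _ _
    have e₁' : m₁ ≫ l.f₁ = b.f₁ := h.lift_snd _ _ _
    -- The components `m₀` and `m₁` were found independently. They are compatible with the middle
    -- maps because the projections `k.f₁` and `l.f₁` out of `s.B` are jointly monic.
    have w₂ : m₀ ≫ s.p₂ = T.p₂ ≫ m₁ := by
      apply h.hom_ext
      · rw [Category.assoc, Category.assoc, ← k.w₂, ← Category.assoc, e₀, e₁, a.w₂]
      · rw [Category.assoc, Category.assoc, ← l.w₂, ← Category.assoc, e₀', e₁', b.w₂]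
    refine ⟨⟨m₀, m₁, ?_, ?_, ?_⟩, hom_ext e₀ e₁, hom_ext e₀' e₁'⟩
    · rw [← k.w₁, ← Category.assoc, e₀, a.w₁]
    -- The induced morphism is itself cartesian: its composite with the cartesian `k` is `a`, which
    -- is cartesian, so cancellation of pullback squares applies.
    · refine IsPullback.of_right ?_ w₂ k.isPullback
      rw [e₀, e₁]
      exact a.isPullback
    · rw [← k.w₃, ← Category.assoc, e₁, a.w₃]

/-- The pullbacks of the `A`s and of the `B`s form the top and bottom of a cube whose vertical maps
are the middle maps. The statement records the square of bases as well, since this explicit pullback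
is what shows that `base` preserves pullbacks. -/
theorem exists_isPullback {p q r : Poly X Y} (f : p ⟶ r) (g : q ⟶ r) :
    ∃ (s : Poly X Y) (k : s ⟶ p) (l : s ⟶ q),
      IsPullback k l f g ∧ IsPullback k.f₁ l.f₁ f.f₁ g.f₁ := by
  have hB := IsPullback.of_hasPullback f.f₁ g.f₁
  have hA := IsPullback.of_hasPullback f.f₀ g.f₀
  let p₂ : pullback f.f₀ g.f₀ ⟶ pullback f.f₁ g.f₁ := hB.lift
    (pullback.fst f.f₀ g.f₀ ≫ p.p₂) (pullback.snd f.f₀ g.f₀ ≫ q.p₂)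
    (by rw [Category.assoc, Category.assoc, ← f.w₂, ← g.w₂, pullback.condition_assoc])
  have ek : pullback.fst f.f₀ g.f₀ ≫ p.p₂ = p₂ ≫ pullback.fst f.f₁ g.f₁ :=
    (hB.lift_fst _ _ _).symm
  have el : pullback.snd f.f₀ g.f₀ ≫ q.p₂ = p₂ ≫ pullback.snd f.f₁ g.f₁ :=
    (hB.lift_snd _ _ _).symm
  -- The face over the first projection lies opposite to the cartesian square of `g`, and the one
  -- over the second projection opposite to that of `f`. The first face also exhibits the new middle
  -- map as a base change of `p.p₂`, whence its exponentiability.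
  have hk := isPullback_side hA hB ek el f.w₂ g.isPullback
  have hl := isPullback_side hA.flip hB.flip el ek g.w₂ f.isPullback
  let s : Poly X Y := ⟨_, _, pullback.fst f.f₀ g.f₀ ≫ p.p₁, p₂, pullback.fst f.f₁ g.f₁ ≫ p.p₃,
    Exponentiable.of_isPullback hk p.exp⟩
  let k : s ⟶ p := ⟨_, _, rfl, hk, rfl⟩
  -- The outer legs of `s` are defined through `p`. They agree with those through `q` because both
  -- are the legs of `r` composed with the common diagonal.
  let l : s ⟶ q := ⟨_, _, by
    change _ = pullback.fst f.f₀ g.f₀ ≫ p.p₁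
    rw [← f.w₁, ← g.w₁, pullback.condition_assoc], hl, by
    change _ = pullback.fst f.f₁ g.f₁ ≫ p.p₃
    rw [← f.w₃, ← g.w₃, pullback.condition_assoc]⟩
  exact ⟨s, k, l, isPullback_of_f₁ (hom_ext hA.w hB.w) hB, hB⟩

instance : HasPullbacks (Poly X Y) :=
  hasPullbacks_of_exists fun f g =>
    let ⟨s, k, l, h, _⟩ := exists_isPullback f g
    ⟨s, k, l, h⟩

/-- The functor sending a polynomial `X ← A → B → Y` to its base `B`. -/
@[simps]
def base (X Y : E) : Poly X Y ⥤ E where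
  obj p := p.B
  map f := f.f₁

/-- Testing one pullback for each cospan is enough, and the constructed one is a pullback on bases
by construction. -/
instance : PreservesLimitsOfShape WalkingCospan (base X Y) :=
  preservesLimitsOfShape_walkingCospan_of_forall_isPullback fun _ _ _ f g _ => exists_isPullback f g

/-- With its converse `isPullback_of_f₁`, this moves every question about pullbacks of polynomials
into `E`. -/
theorem isPullback_f₁ {s p q r : Poly X Y} {k : s ⟶ p} {l : s ⟶ q} {f : p ⟶ r} {g : q ⟶ r}
    (h : IsPullback k l f g) : IsPullback k.f₁ l.f₁ f.f₁ g.f₁ :=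
  h.map (base X Y)

/-! ### Evaluation and composition of polynomials. -/

/-- A polynomial functor preserves pullbacks over its source. -/
theorem isPullback_map (p : Poly X Y) {C₀ C₁ C₂ C₃ : E} {x₀ : C₀ ⟶ X} {x₁ : C₁ ⟶ X}
    {x₂ : C₂ ⟶ X} {x₃ : C₃ ⟶ X} {k : C₀ ⟶ C₁} {l : C₀ ⟶ C₂} {f : C₁ ⟶ C₃} {g : C₂ ⟶ C₃}
    (h : IsPullback k l f g) (hk : k ≫ x₁ = x₀) (hl : l ≫ x₂ = x₀) (hf : f ≫ x₃ = x₁)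
    (hg : g ≫ x₃ = x₂) : IsPullback (p.map k hk) (p.map l hl) (p.map f hf) (p.map g hg) := by
  have w : (Over.homMk k hk : Over.mk x₀ ⟶ Over.mk x₁) ≫
      (Over.homMk f hf : Over.mk x₁ ⟶ Over.mk x₃) =
      (Over.homMk l hl : Over.mk x₀ ⟶ Over.mk x₂) ≫
        (Over.homMk g hg : Over.mk x₂ ⟶ Over.mk x₃) := by
    ext
    exact h.w
  -- The forgetful functor of a slice reflects and preserves pullbacks, so the square can be lifted
  -- to the slice over `X`, sent through `p.functor`, and read off again in `E`.
  have h' := IsPullback.of_map (Over.forget X) w h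
  exact (h'.map p.functor).map (Over.forget Y)

/-- Evaluating a pullback of polynomials at an object gives a pullback. -/
theorem isPullback_app_of_f₁ {s p q r : Poly X Y} {k : s ⟶ p} {l : s ⟶ q} {f : p ⟶ r} {g : q ⟶ r}
    (w : k ≫ f = l ≫ g) (h : IsPullback k.f₁ l.f₁ f.f₁ g.f₁) {C : E} (x : C ⟶ X) :
    IsPullback (app k x) (app l x) (app f x) (app g x) := by
  have w' : app k x ≫ app f x = app l x ≫ app g x := by rw [← app_comp, ← app_comp, w]
  -- By `isPullback_app_out`, s(x), p(x) and q(x) are the fibre products over `r.B` of their bases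
  -- with the constant object r(x).
  exact isPullback_fiberProduct w' h (isPullback_const (r.ext x))
    ((isPullback_app_out k x).paste_horiz (isPullback_app_out f x)).flip
    (isPullback_app_out f x).flip (isPullback_app_out g x).flip
    rfl (Category.id_comp _) (app_out k x) (Category.comp_id _).symm (app_out l x)
    (w'.symm.trans (Category.comp_id _).symm) (app_out f x) rfl (app_out g x) rfl

/-- Composition of polynomials preserves pullbacks, at the level of bases. -/
theorem isPullback_map_app_of_isPullback {s p q r : Poly X Y} {k : s ⟶ p} {l : s ⟶ q}
    {f : p ⟶ r} {g : q ⟶ r} {s' p' q' r' : Poly Y Z} {k' : s' ⟶ p'} {l' : s' ⟶ q'}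
    {f' : p' ⟶ r'} {g' : q' ⟶ r'}
    (w : (s'.map k.f₁ k.w₃ ≫ app k' p.p₃) ≫ p'.map f.f₁ f.w₃ ≫ app f' r.p₃ =
      (s'.map l.f₁ l.w₃ ≫ app l' q.p₃) ≫ q'.map g.f₁ g.w₃ ≫ app g' r.p₃)
    (h : IsPullback k.f₁ l.f₁ f.f₁ g.f₁)
    (w' : k' ≫ f' = l' ≫ g') (h' : IsPullback k'.f₁ l'.f₁ f'.f₁ g'.f₁) :
    IsPullback (s'.map k.f₁ k.w₃ ≫ app k' p.p₃) (s'.map l.f₁ l.w₃ ≫ app l' q.p₃)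
      (p'.map f.f₁ f.w₃ ≫ app f' r.p₃) (q'.map g.f₁ g.w₃ ≫ app g' r.p₃) := by
  -- This separates the two variables: p'(`p.p₃`) is the fibre product over `r'.B` of r'(`p.p₃`),
  -- where only `p` varies, with `p'.B`, where only `p'` varies. Here `hX` is the square of first
  -- factors.
  have hX := r'.isPullback_map h k.w₃ l.w₃ f.w₃ g.w₃
  have ek : (s'.map k.f₁ k.w₃ ≫ app k' p.p₃) ≫ app f' p.p₃ =
      (app k' s.p₃ ≫ app f' s.p₃) ≫ r'.map k.f₁ k.w₃ := by
    rw [Category.assoc, ← app_comp, ← app_comp, map_app]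
  have el : (s'.map l.f₁ l.w₃ ≫ app l' q.p₃) ≫ app g' q.p₃ =
      (app k' s.p₃ ≫ app f' s.p₃) ≫ r'.map l.f₁ l.w₃ := by
    rw [Category.assoc, ← app_comp, ← app_comp, map_app, w']
  -- At the fourth corner the object r'(`r.p₃`) is itself the first factor, so its projection `π₃`
  -- is the identity.
  have ef : (p'.map f.f₁ f.w₃ ≫ app f' r.p₃) ≫ 𝟙 _ = app f' p.p₃ ≫ r'.map f.f₁ f.w₃ := by
    rw [Category.comp_id, map_app]
  have eg : (q'.map g.f₁ g.w₃ ≫ app g' r.p₃) ≫ 𝟙 _ = app g' q.p₃ ≫ r'.map g.f₁ g.w₃ := by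
    rw [Category.comp_id, map_app]
  refine isPullback_fiberProduct w hX h'
    ((isPullback_app_out k' s.p₃).paste_horiz (isPullback_app_out f' s.p₃))
    (isPullback_app_out f' p.p₃) (isPullback_app_out g' q.p₃) (ρ₃ := r'.out r.p₃)
    (map_out ..) rfl ek ?_ el ?_ ef ?_ eg ?_
  -- The remaining equations concern the projections to the bases of the second polynomials: `map`
  -- does not move that base, and `app` acts on it by the base component of the 2-cell.
  all_goals rw [Category.assoc, app_out, map_out_assoc]

/-- The base of a composite is the value of the second polynomial at the third leg of the first. A
horizontal composite therefore acts on bases by functoriality followed by a component, which is the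
form treated in `isPullback_map_app_of_isPullback`. -/
theorem compMap_f₁ {p q : Poly X Y} {p' q' : Poly Y Z} (f : p ⟶ q) (f' : p' ⟶ q') :
    (whiskerRight f p' ≫ whiskerLeft q f').f₁ = p'.map f.f₁ f.w₃ ≫ app f' q.p₃ := by
  rw [comp_f₁, whiskerRight_f₁, whiskerLeft_f₁]

end Poly

/-! ### Pullbacks of pullback-preserving functors, computed pointwise. -/

namespace PbFunctor

variable {C D K : CatPb.{v, u}}

/-- A pointwise pullback is a pullback among all natural transformations. What remains is that the
induced transformation is cartesian. -/
theorem isPullback_of_app {s p q r : PbFunctor C D} {k : s ⟶ p} {l : s ⟶ q} {f : p ⟶ r}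
    {g : q ⟶ r} (w : k ≫ f = l ≫ g)
    (h : ∀ X, IsPullback (k.nat.app X) (l.nat.app X) (f.nat.app X) (g.nat.app X)) :
    IsPullback k l f g := by
  have h' : IsPullback k.nat l.nat f.nat g.nat := IsPullback.of_forall_isPullback_app h
  refine IsPullback.mk' w ?_ ?_
  · intro T φ φ' e e'
    exact CartTrans.ext (h'.hom_ext (congrArg CartTrans.nat e) (congrArg CartTrans.nat e'))
  · intro T a b e
    let m := h'.lift a.nat b.nat (congrArg CartTrans.nat e)
    have e₁ : m ≫ k.nat = a.nat := h'.lift_fst _ _ _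
    have e₂ : m ≫ l.nat = b.nat := h'.lift_snd _ _ _
    refine ⟨⟨m, fun i j t => ?_⟩, CartTrans.ext e₁, CartTrans.ext e₂⟩
    -- Cancellation: `m` followed by the cartesian `k` is the cartesian `a`, so the naturality
    -- squares of `m` are pullbacks.
    refine IsPullback.of_bot ?_ (m.naturality t) (k.cartesian t)
    rw [← NatTrans.comp_app, ← NatTrans.comp_app, e₁]
    exact a.cartesian t

/-- The pullback taken in the functor category already works. The cube lemma, applied to the
naturality squares, makes its projections cartesian. The pointwise clause is kept so that
preservation by `eval` can be read off. -/
theorem exists_isPullback {p q r : PbFunctor C D} (f : p ⟶ r) (g : q ⟶ r) :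
    ∃ (s : PbFunctor C D) (k : s ⟶ p) (l : s ⟶ q), IsPullback k l f g ∧
      ∀ X, IsPullback (k.nat.app X) (l.nat.app X) (f.nat.app X) (g.nat.app X) := by
  have h := IsPullback.of_hasPullback f.nat g.nat
  let k := pullback.fst f.nat g.nat
  let l := pullback.snd f.nat g.nat
  have hk : NatTrans.Equifibered k := fun i j t =>
    (isPullback_side (h.app i) (h.app j) (k.naturality t).symm (l.naturality t).symm
      (f.nat.naturality t).symm (g.cartesian t).flip).flip
  have hl : NatTrans.Equifibered l := fun i j t =>
    (isPullback_side (h.app i).flip (h.app j).flip (l.naturality t).symm (k.naturality t).symm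
      (g.nat.naturality t).symm (f.cartesian t).flip).flip
  have hs : PreservesLimitsOfShape WalkingCospan (pullback f.nat g.nat) := by
    refine preservesPullbacks_of_map _ fun {c₀ c₁ c₂ c₃ κ μ φ γ} hc => ?_
    have w := congrArg (pullback f.nat g.nat).map hc.w
    rw [Functor.map_comp, Functor.map_comp] at w
    -- Only the cartesian projection to `p` matters here. Writing P for the pullback functor, it
    -- makes P(c) the fibre product over p(c₃) of p(c) with the constant object P(c₃), for c each of
    -- c₀, c₁, c₂. Since p preserves pullbacks, so does P.
    refine isPullback_fiberProduct w (hc.map p.functor)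
      (isPullback_const ((pullback f.nat g.nat).obj c₃))
      ((hk κ).paste_horiz (hk φ)).flip (hk φ).flip (hk γ).flip rfl (Category.id_comp _)
      (k.naturality κ) (Category.comp_id _).symm (k.naturality μ)
      (w.symm.trans (Category.comp_id _).symm) (k.naturality φ) rfl (k.naturality γ) rfl
  exact ⟨⟨_, hs⟩, ⟨k, hk⟩, ⟨l, hl⟩, isPullback_of_app (CartTrans.ext h.w) h.app, h.app⟩

instance : HasPullbacks (PbFunctor C D) :=
  hasPullbacks_of_exists fun f g =>
    let ⟨s, k, l, h, _⟩ := exists_isPullback f g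
    ⟨s, k, l, h⟩

/-- Evaluation of pullback preserving functors at an object. -/
@[simps]
def eval (D : CatPb.{v, u}) (X : C.carrier) : PbFunctor C D ⥤ D.carrier where
  obj F := F.functor.obj X
  map f := f.nat.app X

instance (X : C.carrier) : PreservesLimitsOfShape WalkingCospan (eval D X) :=
  preservesLimitsOfShape_walkingCospan_of_forall_isPullback fun _ _ _ f g _ =>
    let ⟨s, k, l, h, h'⟩ := exists_isPullback f g
    ⟨s, k, l, h, h' X⟩

/-- Every pullback of cartesian transformations is pointwise, because the constructed one is and
pullbacks are unique up to isomorphism. -/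
theorem isPullback_app {s p q r : PbFunctor C D} {k : s ⟶ p} {l : s ⟶ q} {f : p ⟶ r}
    {g : q ⟶ r} (h : IsPullback k l f g) (X : C.carrier) :
    IsPullback (k.nat.app X) (l.nat.app X) (f.nat.app X) (g.nat.app X) :=
  h.map (eval D X)

/-- Horizontal composition of pullback squares of pullback preserving functors, at an object. -/
theorem isPullback_map_app {s p q r : PbFunctor C D} {k : s ⟶ p} {l : s ⟶ q} {f : p ⟶ r}
    {g : q ⟶ r} {s' p' q' r' : PbFunctor D K} {k' : s' ⟶ p'} {l' : s' ⟶ q'} {f' : p' ⟶ r'}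
    {g' : q' ⟶ r'} (h : IsPullback k l f g) (h' : IsPullback k' l' f' g') (X : C.carrier)
    (w : (s'.functor.map (k.nat.app X) ≫ k'.nat.app _) ≫
        p'.functor.map (f.nat.app X) ≫ f'.nat.app _ =
      (s'.functor.map (l.nat.app X) ≫ l'.nat.app _) ≫
        q'.functor.map (g.nat.app X) ≫ g'.nat.app _) :
    IsPullback (s'.functor.map (k.nat.app X) ≫ k'.nat.app _)
      (s'.functor.map (l.nat.app X) ≫ l'.nat.app _)
      (p'.functor.map (f.nat.app X) ≫ f'.nat.app _)
      (q'.functor.map (g.nat.app X) ≫ g'.nat.app _) := by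
  -- The presentation of s'(s X) as a fibre product uses the diagonal written as `k` then `f`. These
  -- equations allow the projections along `l` and `g` to be compared with it too.
  have e : (k ≫ f).nat.app X = l.nat.app X ≫ g.nat.app X := by rw [h.w]; rfl
  have e' : (k' ≫ f').nat = l'.nat ≫ g'.nat := by rw [h'.w]; rfl
  -- The naturality square of `f'` at the component of `f` makes p'(p X) the fibre product over r'(r
  -- X) of r'(p X) and p'(r X). The first factor varies in the image under `r'` of the unprimed
  -- square, and the second in the primed square evaluated at r X. At the last corner both factors
  -- are r'(r X) itself, hence the identities `π₃` and `ρ₃`.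
  refine isPullback_fiberProduct w ((isPullback_app h X).map r'.functor)
    (isPullback_app h' (r.functor.obj X)) ((k' ≫ f').cartesian ((k ≫ f).nat.app X)).flip
    (f'.cartesian (f.nat.app X)).flip (g'.cartesian (g.nat.app X)).flip
    (π₃ := 𝟙 _) (ρ₃ := 𝟙 _) (r'.functor.map_comp _ _).symm rfl ?_ ?_ ?_ ?_ ?_ ?_ ?_ ?_
  · rw [Category.assoc]
    exact (k' ≫ f').nat.naturality (k.nat.app X)
  · rw [Category.assoc, ← k'.nat.naturality, ← Category.assoc, ← Functor.map_comp]
    rfl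
  · rw [Category.assoc, e', ← NatTrans.naturality]
    rfl
  · rw [Category.assoc, ← l'.nat.naturality, ← Category.assoc, ← Functor.map_comp, e]
  · rw [Category.comp_id, f'.nat.naturality]
  · rw [Category.comp_id]
  · rw [Category.comp_id, g'.nat.naturality]
  · rw [Category.comp_id]

end PbFunctor

/-! ### The three assertions of the theorem. -/

theorem isCatPbBicategory_polyObj : IsCatPbBicategory (PolyObj E) where
  hasPullbacks a b := inferInstanceAs (HasPullbacks (Poly a.obj b.obj))
  preserves a b c := by
    have : HasPullbacks (a ⟶ b) := inferInstanceAs (HasPullbacks (Poly a.obj b.obj))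
    have : HasPullbacks (b ⟶ c) := inferInstanceAs (HasPullbacks (Poly b.obj c.obj))
    refine preservesPullbacks_of_prod_map _ fun {s p q r k l f g} h h' => ?_
    have w : (compFunctor a b c).map k ≫ (compFunctor a b c).map f =
        (compFunctor a b c).map l ≫ (compFunctor a b c).map g := by
      rw [← Functor.map_comp, ← Functor.map_comp, (isPullback_prod h h').w]
    have w₁ := congrArg Poly.Hom.f₁ w
    have ek := Poly.compMap_f₁ k.1 k.2
    have el := Poly.compMap_f₁ l.1 l.2
    have ef := Poly.compMap_f₁ f.1 f.2
    have eg := Poly.compMap_f₁ g.1 g.2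
    -- Only the bases of the composites remain to be compared; their first objects take care of
    -- themselves by cartesianness.
    refine Poly.isPullback_of_f₁ w ?_
    change IsPullback (Poly.whiskerRight k.1 s.2 ≫ Poly.whiskerLeft p.1 k.2).f₁
      (Poly.whiskerRight l.1 s.2 ≫ Poly.whiskerLeft q.1 l.2).f₁
      (Poly.whiskerRight f.1 p.2 ≫ Poly.whiskerLeft r.1 f.2).f₁
      (Poly.whiskerRight g.1 q.2 ≫ Poly.whiskerLeft r.1 g.2).f₁
    replace w₁ : (Poly.whiskerRight k.1 s.2 ≫ Poly.whiskerLeft p.1 k.2).f₁ ≫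
        (Poly.whiskerRight f.1 p.2 ≫ Poly.whiskerLeft r.1 f.2).f₁ =
      (Poly.whiskerRight l.1 s.2 ≫ Poly.whiskerLeft q.1 l.2).f₁ ≫
        (Poly.whiskerRight g.1 q.2 ≫ Poly.whiskerLeft r.1 g.2).f₁ := w₁
    simp only [ek, el, ef, eg] at w₁ ⊢
    exact Poly.isPullback_map_app_of_isPullback w₁ (Poly.isPullback_f₁ h) h'.w
      (Poly.isPullback_f₁ h')

theorem isCatPbBicategory_catPb : IsCatPbBicategory CatPb.{v, u} where
  hasPullbacks C D := inferInstanceAs (HasPullbacks (PbFunctor C D))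
  preserves C D K := by
    have : HasPullbacks (C ⟶ D) := inferInstanceAs (HasPullbacks (PbFunctor C D))
    have : HasPullbacks (D ⟶ K) := inferInstanceAs (HasPullbacks (PbFunctor D K))
    refine preservesPullbacks_of_prod_map _ fun {s p q r k l f g} h h' => ?_
    have w : (compFunctor C D K).map k ≫ (compFunctor C D K).map f =
        (compFunctor C D K).map l ≫ (compFunctor C D K).map g := by
      rw [← Functor.map_comp, ← Functor.map_comp, (isPullback_prod h h').w]
    -- The component at X of a horizontal composite is the second functor applied to a component,
    -- followed by a component of the second transformation.
    exact PbFunctor.isPullback_of_app w fun X => PbFunctor.isPullback_map_app h h' X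
      (congrArg (fun t => (CartTrans.nat t).app X) w)

theorem isCatPbHom_polyFunctor : IsCatPbHom (polyFunctor E) where
  preserves a b := by
    have : HasPullbacks (a ⟶ b) := inferInstanceAs (HasPullbacks (Poly a.obj b.obj))
    refine preservesPullbacks_of_map _ fun {s p q r k l f g} h => ?_
    have w := congrArg ((polyFunctor E).toPrelaxFunctor.mapFunctor a b).map h.w
    rw [Functor.map_comp, Functor.map_comp] at w
    refine PbFunctor.isPullback_of_app w fun x => ?_
    -- Pullbacks in the slice are reflected by the forgetful functor, and the underlying map of each
    -- component is `Poly.app`, so evaluation of the polynomials at `x.hom` decides the matter.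
    exact IsPullback.of_map (Over.forget b.obj) (congrArg (fun t => (CartTrans.nat t).app x) w)
      (Poly.isPullback_app_of_f₁ h.w (Poly.isPullback_f₁ h) x.hom)

end PolyPb

theorem mainTheorem3 (E : Type u) [Category.{v} E] [HasPullbacks E] :
    PolyPb.IsCatPbBicategory (PolyPb.PolyObj E) ∧
      PolyPb.IsCatPbBicategory PolyPb.CatPb.{v, max u v} ∧
      PolyPb.IsCatPbHom (PolyPb.polyFunctor E) :=
  ⟨PolyPb.isCatPbBicategory_polyObj, PolyPb.isCatPbBicategory_catPb,
    PolyPb.isCatPbHom_polyFunctor⟩
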